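/- **Definitions.** A *complex model* of dimension $k$ is an orbit space $\tilde V/\Gamma$ (with the quotient topology), where $\tilde V$ is a connected, simply connected complex manifold of dimension $k$ and $\Gamma$ is a discrete (countable) group acting on $\tilde V$ by holomorphic maps such that the set of points with trivial stabilizer is connected and dense. Let $p:\tilde V\to\tilde V/\Gamma$ be the projection. An open set $W\subset\tilde V/\Gamma$ is a *submodel* if $p^{-1}(W)$ is connected and $W^\#/\Lambda$ is a model, where $W^\#$ is the universal cover of $p^{-1}(W)$ and $\Lambda$ is the group of all biholomorphisms of $W^\#$ that cover the action of some element of $\Gamma$. A bijection of (sub)models is a *biholomorphism of models* if it lifts to a biholomorphism of the corresponding simply connected manifolds. A *chart* of dimension $k$ on a topological space $M$ is a homeomorphism $\phi:\tilde V/\Gamma\to V$ from a model with $\tilde V\subset\mathbb C^k$ open onto an open set $V\subset M$. Two charts $\phi,\phi'$ with images $V,V'$ are *compatible* if $V\cap V'=\emptyset$ or if $\phi^{-1}(V\cap V')$ and $\phi'^{-1}(V\cap V')$ are submodels and $\phi'^{-1}\circ\phi$ is a biholomorphism of models between them. A *complex quasifold structure* of dimension $k$ on $M$ is a maximal collection (atlas)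 of pairwise compatible charts of dimension $k$ whose images cover $M$. For quasifolds $D,M,N$, a continuous map $f:D\times M\to N$ is *holomorphic* if for every $(a,m)$ there are charts $\phi,\phi',\psi$ of $D,M,N$ around $a,m,f(a,m)$ such that $f\circ(\phi\times\phi')$ lifts to a holomorphic map from the product of the simply connected domains of $\phi$ and $\phi'$ to that of $\psi$. **Theorem 2.2.** Let $\mathfrak d$ be a real vector space of dimension $n$ and let $\Delta\subset\mathfrak d^*$ be a convex polytope of dimension $n$ that is simple, i.e. exactly $n$ edges stem from each vertex (no rationality is assumed). Let $X_1,\dots,X_d\in\mathfrak d$ be inward-pointing normals to the facets of $\Delta$, one for each facet, so that $\Delta=\bigcap_{j=1}^d\{\mu\in\mathfrak d^*\mid\langle\mu,X_j\rangle\ge\lambda_j\}$ with real numbers $\lambda_j$. Let $Q\subset\mathfrak d$ be a quasilattice (the $\mathbb Z$-span of a finite set that spans $\mathfrak d$ over $\mathbb R$) containing $X_1,\dots,X_d$. Put $\mathfrak d_{\mathbb C}=\mathbb C\otimes_{\mathbb R}\mathfrak d$ and let $T^d_{\mathbb C}=\mathbb C^d/\mathbb Z^d$ act on $\mathbb C^d$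 by $[Z]\cdot z=(e^{2\pi iZ_j}z_j)_j$. Let $N_{\mathbb C}$ be the kernel of the homomorphism $\Pi_{\mathbb C}:T^d_{\mathbb C}\to\mathfrak d_{\mathbb C}/Q$ induced by $e_j\mapsto X_j$. For a nonempty face $F$ of $\Delta$ (with $\Delta$ itself allowed) let $\mathbb C^d_F$ be the set of $z\in\mathbb C^d$ such that, for each $j$, $z_j=0$ if and only if $\langle\mu,X_j\rangle=\lambda_j$ for all $\mu\in F$; let $\mathbb C^d_\Delta=\bigcup_F\mathbb C^d_F$. Give $\mathbb C^d_\Delta/N_{\mathbb C}$ and $\mathfrak d_{\mathbb C}/Q$ the quotient topologies. Then: 1. The complex quasitorus $\mathfrak d_{\mathbb C}/Q$ has a complex quasifold structure of dimension $n$ containing the chart $\mathfrak d_{\mathbb C}/Q\to\mathfrak d_{\mathbb C}/Q$, where $Q$ acts on $\mathfrak d_{\mathbb C}\simeq\mathbb C^n$ by translations. 2. $\mathbb C^d_\Delta/N_{\mathbb C}$ has a complex quasifold structure of dimension $n$ whose atlas contains, for each vertex $\mu$ of $\Delta$, the following chart, and the images of these charts cover. Let $I=\{j\mid\langle\mu,X_j\rangle=\lambda_j\}$,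 which has $n$ elements; let $z^\mu\in\mathbb C^d$ have coordinates $0$ for $j\in I$ and $1$ for $j\notin I$; and let $\Gamma_\mu$ be the intersection of $N_{\mathbb C}$ with the stabilizer of $z^\mu$ in $T^d_{\mathbb C}$, acting on $\prod_{j\in I}\mathbb Ce_j\simeq\mathbb C^n$ by restriction of the action on $\mathbb C^d$. The chart is $$\mathbb C^n/\Gamma_\mu\to V_\mu=\{[z]\in\mathbb C^d_\Delta/N_{\mathbb C}\mid z_j\ne0\text{ for all }j\notin I\},\qquad[z]\mapsto[z^\mu+z].$$ 3. There is an action of $\mathfrak d_{\mathbb C}/Q$ on $\mathbb C^d_\Delta/N_{\mathbb C}$ with $\Pi_{\mathbb C}(t)\cdot[z]=[t\cdot z]$ for all $t\in T^d_{\mathbb C}$ and $z\in\mathbb C^d_\Delta$. It is holomorphic as a map $(\mathfrak d_{\mathbb C}/Q)\times(\mathbb C^d_\Delta/N_{\mathbb C})\to\mathbb C^d_\Delta/N_{\mathbb C}$ for all quasifold structures as in 1 and 2, and it has a dense open orbit. -/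

import Mathlib

open TopologicalSpace
open scoped Manifold TensorProduct

noncomputable section

namespace Quasifold

/-! ### Complex models -/

/-- A connected, simply connected complex manifold `V` of dimension `k` (modelled on `ℂ^k`, with
holomorphic changes of coordinates), together with a discrete group `G` acting on it by holomorphic
maps, so that the set of points where the action is free is connected and dense. The model itself is
the orbit space `V/G` with its quotient topology. A discrete group, being a zero-dimensional Lie
group, is a countable group with no further structure. Simple connectedness includes
connectedness. -/
structure IsComplexModel (k : ℕ) (V : Type) [TopologicalSpace V] [ChartedSpace (Fin k → ℂ) V]
    (G : Type) [Group G] [MulAction G V] : Prop where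
  isManifold : IsManifold 𝓘(ℂ, Fin k → ℂ) 1 V
  t2 : T2Space V
  secondCountable : SecondCountableTopology V
  simplyConnected : SimplyConnectedSpace V
  discrete : Countable G
  holomorphic : ∀ g : G, MDifferentiable 𝓘(ℂ, Fin k → ℂ) 𝓘(ℂ, Fin k → ℂ) (fun v : V => g • v)
  connected_free : IsConnected {v : V | MulAction.stabilizer G v = ⊥}
  dense_free : Dense {v : V | MulAction.stabilizer G v = ⊥}

/-- A holomorphic universal cover of a `k`-dimensional complex manifold `U`. -/
structure UniversalCover (k : ℕ) (U : Type) [TopologicalSpace U]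
    [ChartedSpace (Fin k → ℂ) U] where
  total : Type
  [topology : TopologicalSpace total]
  [charted : ChartedSpace (Fin k → ℂ) total]
  isManifold : IsManifold 𝓘(ℂ, Fin k → ℂ) 1 total
  simplyConnected : SimplyConnectedSpace total
  proj : total → U
  isCovering : IsCoveringMap proj
  surjective : Function.Surjective proj
  holomorphic : MDifferentiable 𝓘(ℂ, Fin k → ℂ) 𝓘(ℂ, Fin k → ℂ) proj

attribute [instance] UniversalCover.topology UniversalCover.charted

/-- Let `G` act on `V`, let `U ⊆ V` be open and let `A → U` be its universal cover. This is the group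
of all biholomorphisms `f` of `A` that cover the action of some element of `G`. (When `U` is
`G`-invariant this is the extension of `G` by the fundamental group of `U`, and its orbit space
is `U/G`.) -/
def liftGroup {k : ℕ} {V : Type} [TopologicalSpace V] [ChartedSpace (Fin k → ℂ) V]
    (G : Type) [Group G] [MulAction G V] (U : Opens V) (A : UniversalCover k U) :
    Subgroup (Equiv.Perm A.total) where
  carrier := {f | MDifferentiable 𝓘(ℂ, Fin k → ℂ) 𝓘(ℂ, Fin k → ℂ) f ∧
    MDifferentiable 𝓘(ℂ, Fin k → ℂ) 𝓘(ℂ, Fin k → ℂ) f.symm ∧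
    ∃ g : G, ∀ u : A.total, (A.proj (f u) : V) = g • (A.proj u : V)}
  one_mem' := ⟨mdifferentiable_id, mdifferentiable_id, 1, fun u => by simp⟩
  mul_mem' := by
    rintro f₁ f₂ ⟨h₁, h₁', g₁, e₁⟩ ⟨h₂, h₂', g₂, e₂⟩
    refine ⟨h₁.comp h₂, h₂'.comp h₁', g₁ * g₂, fun u => ?_⟩
    rw [Equiv.Perm.mul_apply, e₁, e₂, mul_smul]
  inv_mem' := by
    rintro f ⟨h, h', g, e⟩
    refine ⟨h', h, g⁻¹, fun u => ?_⟩
    rw [eq_inv_smul_iff, ← e, ← Equiv.Perm.mul_apply, mul_inv_cancel, Equiv.Perm.one_apply]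

/-! ### Charts, atlases, quasifolds -/

/-- A `k`-dimensional chart `(target, φ, domain/Γ)` on `M`: `domain` is an open, connected and simply
connected subset of `ℂ^k` with an action of a discrete group `Γ` making `domain/Γ` a model, and `φ`
is a homeomorphism of `domain/Γ` onto the open subset `target` of `M`. -/
structure Chart (k : ℕ) (M : Type*) [TopologicalSpace M] where
  domain : Opens (Fin k → ℂ)
  Γ : Type
  [group : Group Γ]
  [action : MulAction Γ domain]
  isModel : IsComplexModel k domain Γ
  target : Opens M
  φ : MulAction.orbitRel.Quotient Γ domain ≃ₜ target

attribute [instance] Chart.group Chart.action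

namespace Chart

variable {k : ℕ} {M : Type*} [TopologicalSpace M]

/-- The composite `φ ∘ p : domain → domain/Γ → M`. -/
def toSpace (c : Chart k M) (v : c.domain) : M :=
  (c.φ (Quotient.mk (MulAction.orbitRel c.Γ c.domain) v) : M)

theorem continuous_toSpace (c : Chart k M) : Continuous c.toSpace :=
  continuous_subtype_val.comp (c.φ.continuous.comp continuous_quotient_mk')

/-- The open subset `p⁻¹(φ⁻¹(c.target ∩ c'.target))` of the domain of `c`. -/
def overlap (c c' : Chart k M) : Opens c.domain :=
  ⟨c.toSpace ⁻¹' (c'.target : Set M), c'.target.isOpen.preimage c.continuous_toSpace⟩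

/-- Compatibility of two charts. If their targets meet, then `φ⁻¹(V ∩ V')` and `φ'⁻¹(V ∩ V')` are
submodels, that is, their inverse images in the two domains have universal covers `A` and `B` on
which the groups of lifts define models, and the change of charts `φ'⁻¹ ∘ φ` is a biholomorphism of
these models, that is, it lifts to a biholomorphism `g : A → B`. -/
def Compatible (c c' : Chart k M) : Prop :=
  ((c.target : Set M) ∩ c'.target).Nonempty →
    ∃ (A : UniversalCover k (c.overlap c')) (B : UniversalCover k (c'.overlap c)),
      IsComplexModel k A.total (liftGroup c.Γ (c.overlap c') A) ∧
      IsComplexModel k B.total (liftGroup c'.Γ (c'.overlap c) B) ∧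
      ∃ g : A.total ≃ B.total,
        MDifferentiable 𝓘(ℂ, Fin k → ℂ) 𝓘(ℂ, Fin k → ℂ) g ∧
        MDifferentiable 𝓘(ℂ, Fin k → ℂ) 𝓘(ℂ, Fin k → ℂ) g.symm ∧
        ∀ u : A.total, c'.toSpace (B.proj (g u)) = c.toSpace (A.proj u)

end Chart

/-- A complex quasifold structure of dimension `k` on the topological space `M`: a maximal atlas of
pairwise compatible charts whose targets cover `M`. -/
structure ComplexQuasifold (k : ℕ) (M : Type*) [TopologicalSpace M] where
  atlas : Set (Chart k M)
  cover : ∀ m : M, ∃ c ∈ atlas, m ∈ c.target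
  compatible : ∀ c ∈ atlas, ∀ c' ∈ atlas, c.Compatible c'
  maximal : ∀ c : Chart k M, (∀ c' ∈ atlas, c.Compatible c') → c ∈ atlas

/-- Holomorphic maps `D × M → N` of complex quasifolds, where the product quasifold `D × M` is given
by the products `(domain × domain')/(Γ × Γ')` of charts of `D` and `M`: the map is continuous and,
around each point of `D × M` and its image, it has a holomorphic lift from such a product chart to a
chart of `N`. -/
def IsHolomorphicOnProd {k l r : ℕ} {D M N : Type*} [TopologicalSpace D] [TopologicalSpace M]
    [TopologicalSpace N] (𝒟 : ComplexQuasifold k D) (𝒜 : ComplexQuasifold l M)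
    (ℬ : ComplexQuasifold r N) (f : D × M → N) : Prop :=
  Continuous f ∧ ∀ (a : D) (m : M), ∃ c ∈ 𝒟.atlas, ∃ c' ∈ 𝒜.atlas, ∃ e ∈ ℬ.atlas,
    a ∈ c.target ∧ m ∈ c'.target ∧ f (a, m) ∈ e.target ∧
    ∃ F : c.domain × c'.domain → e.domain,
      MDifferentiable (𝓘(ℂ, Fin k → ℂ).prod 𝓘(ℂ, Fin l → ℂ)) 𝓘(ℂ, Fin r → ℂ) F ∧
      ∀ v w, e.toSpace (F (v, w)) = f (c.toSpace v, c'.toSpace w)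

/-! ### Polytopes in the dual of a real vector space -/

section Polytope

variable {E : Type*} [AddCommGroup E] [Module ℝ E]

/-- The nonempty faces of `Δ ⊆ E*`: the sets of points of `Δ` where a linear function, i.e. an
element `x` of `E`, attains its minimum on `Δ` (`Δ` itself is the face with `x = 0`). -/
def IsFace (Δ F : Set (Module.Dual ℝ E)) : Prop :=
  F.Nonempty ∧ ∃ x : E, F = {μ ∈ Δ | ∀ ν ∈ Δ, μ x ≤ ν x}

/-- The dimension of (the affine span of) a nonempty set. -/
def dim (F : Set (Module.Dual ℝ E)) : ℕ :=
  Module.finrank ℝ (vectorSpan ℝ F)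

/-- `v` is a vertex of `Δ`. -/
def IsVertex (Δ : Set (Module.Dual ℝ E)) (v : Module.Dual ℝ E) : Prop :=
  IsFace Δ {v}

/-- A simple convex polytope of dimension `n`: the convex hull of a finite nonempty set, of dimension
`n`, such that exactly `n` edges stem from each of its vertices. -/
structure IsSimplePolytope (n : ℕ) (Δ : Set (Module.Dual ℝ E)) : Prop where
  nonempty : Δ.Nonempty
  polytope : ∃ s : Finset (Module.Dual ℝ E), Δ = convexHull ℝ (s : Set (Module.Dual ℝ E))
  dim_eq : dim Δ = n
  simple : ∀ v, IsVertex Δ v → {F | IsFace Δ F ∧ dim F = 1 ∧ v ∈ F}.encard = n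

/-- The part of `Δ` on the hyperplane `⟨μ, X j⟩ = lam j`. -/
def facet {d : ℕ} (Δ : Set (Module.Dual ℝ E)) (X : Fin d → E) (lam : Fin d → ℝ) (j : Fin d) :
    Set (Module.Dual ℝ E) :=
  {μ ∈ Δ | μ (X j) = lam j}

/-- `X 1, …, X d` are inward-pointing normals to the facets of the `n`-dimensional polytope `Δ`, one
for each facet: `Δ` is the intersection of the half-spaces `⟨μ, X j⟩ ≥ lam j`, and the equalities
`⟨μ, X j⟩ = lam j` define pairwise different facets, i.e. faces of dimension `n - 1`. -/
structure AreInwardNormals {d : ℕ} (n : ℕ) (Δ : Set (Module.Dual ℝ E)) (X : Fin d → E)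
    (lam : Fin d → ℝ) : Prop where
  eq_inter : Δ = ⋂ j, {μ | lam j ≤ μ (X j)}
  isFace : ∀ j, IsFace Δ (facet Δ X lam j)
  codim_one : ∀ j, dim (facet Δ X lam j) + 1 = n
  injective : Function.Injective (facet Δ X lam)

/-- A quasilattice: the `ℤ`-span of a finite set of vectors that spans the vector space. -/
def IsQuasilattice (Q : AddSubgroup E) : Prop :=
  ∃ s : Finset E, Submodule.span ℝ (s : Set E) = ⊤ ∧ Q = AddSubgroup.closure (s : Set E)

end Polytope

/-! ### Complex tori and quasitori -/

section Torus

/-- The subgroup `ℤ^d` of `ℂ^d`. -/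
def intLattice (d : ℕ) : AddSubgroup (Fin d → ℂ) :=
  ((Int.castAddHom ℂ).compLeft (Fin d)).range

/-- The complex torus `T^d_ℂ = ℂ^d/ℤ^d`. -/
abbrev Torus (d : ℕ) : Type := (Fin d → ℂ) ⧸ intLattice d

/-- The isomorphism of `ℂ^d/ℤ^d` with `(ℂ*)^d`, `[Z] ↦ (exp (2πi Z_1), …, exp (2πi Z_d))`. -/
def torusExp (d : ℕ) : Torus d →+ Additive (Fin d → ℂˣ) :=
  QuotientAddGroup.lift (intLattice d)
    { toFun := fun Z => Additive.ofMul fun j =>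
        Units.mk0 (Complex.exp (2 * Real.pi * Complex.I * Z j)) (Complex.exp_ne_zero _)
      map_zero' := by
        apply Additive.toMul.injective
        funext j
        ext
        simp
      map_add' := by
        intro Z W
        apply Additive.toMul.injective
        funext j
        ext
        simp [mul_add, Complex.exp_add] }
    (by
      rintro _ ⟨m, rfl⟩
      apply Additive.toMul.injective
      funext j
      ext
      simpa [mul_comm] using Complex.exp_int_mul_two_pi_mul_I (m j))

/-- The standard action of `T^d_ℂ` on `ℂ^d`, `[Z] · z = (exp (2πi Z_j) z_j)_j`. -/
instance torusAction (d : ℕ) : AddAction (Torus d) (Fin d → ℂ) where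
  vadd t z := fun j => (Additive.toMul (torusExp d t) j : ℂ) * z j
  zero_vadd z := by
    funext j
    change (Additive.toMul (torusExp d 0) j : ℂ) * z j = z j
    simp
  add_vadd s t z := by
    funext j
    change (Additive.toMul (torusExp d (s + t)) j : ℂ) * z j =
      (Additive.toMul (torusExp d s) j : ℂ) * ((Additive.toMul (torusExp d t) j : ℂ) * z j)
    simp [mul_assoc]

theorem torus_vadd_apply {d : ℕ} (t : Torus d) (z : Fin d → ℂ) (j : Fin d) :
    (t +ᵥ z) j = (Additive.toMul (torusExp d t) j : ℂ) * z j := rfl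

variable {E : Type*} [AddCommGroup E] [Module ℝ E]

/-- The image of `Q ⊆ E` in the complexification `ℂ ⊗ E = E + iE`. -/
def complexLattice (Q : AddSubgroup E) : AddSubgroup (ℂ ⊗[ℝ] E) :=
  Q.map (TensorProduct.mk ℝ ℂ E 1).toAddMonoidHom

/-- The complex quasitorus `E_ℂ/Q`. -/
def Quasitorus (Q : AddSubgroup E) : Type _ := (ℂ ⊗[ℝ] E) ⧸ complexLattice Q

instance (Q : AddSubgroup E) : AddCommGroup (Quasitorus Q) :=
  inferInstanceAs (AddCommGroup ((ℂ ⊗[ℝ] E) ⧸ complexLattice Q))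

/-- The exponential mapping `E_ℂ → E_ℂ/Q`. -/
def Quasitorus.mk (Q : AddSubgroup E) : (ℂ ⊗[ℝ] E) →+ Quasitorus Q :=
  QuotientAddGroup.mk' (complexLattice Q)

/-- The quotient topology, `E_ℂ` having its vector space topology. -/
instance (Q : AddSubgroup E) : TopologicalSpace (Quasitorus Q) :=
  (moduleTopology ℂ (ℂ ⊗[ℝ] E)).coinduced (Quasitorus.mk Q)

/-- `c` is the one chart of the complex quasitorus `E_ℂ/Q`: after the choice of a basis `b` of `E`,
which identifies `E_ℂ` with `ℂ^n`, it is the whole of `E_ℂ/Q` with the group `Q` acting on `E_ℂ` by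
translations. -/
def IsQuasitorusChart {n : ℕ} (Q : AddSubgroup E) (c : Chart n (Quasitorus Q)) : Prop :=
  ∃ b : Module.Basis (Fin n) ℝ E,
    c.domain = ⊤ ∧ c.target = ⊤ ∧
    (∃ θ : c.Γ ≃* Multiplicative Q, ∀ (g : c.Γ) (z : c.domain) (i : Fin n),
      ((g • z : c.domain) : Fin n → ℂ) i =
        (z : Fin n → ℂ) i + (b.repr ((θ g).toAdd : E) i : ℂ)) ∧
    ∀ z : c.domain, c.toSpace z = Quasitorus.mk Q (∑ i, (z : Fin n → ℂ) i ⊗ₜ[ℝ] b i)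

variable {d : ℕ}

/-- The complex linear map `π_ℂ : ℂ^d → E_ℂ`, `e_j ↦ X j`. -/
def complexProj (X : Fin d → E) : (Fin d → ℂ) →ₗ[ℂ] ℂ ⊗[ℝ] E :=
  Fintype.linearCombination ℂ fun j => (1 : ℂ) ⊗ₜ[ℝ] X j

theorem intLattice_le_comap (X : Fin d → E) (Q : AddSubgroup E) (hX : ∀ j, X j ∈ Q) :
    intLattice d ≤ (complexLattice Q).comap (complexProj X).toAddMonoidHom := by
  rintro _ ⟨m, rfl⟩
  refine ⟨∑ j, m j • X j, sum_mem fun j _ => Q.zsmul_mem (hX j) _, ?_⟩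
  have h : ∀ j, (m j : ℂ) • (1 : ℂ) ⊗ₜ[ℝ] X j = m j • (1 : ℂ) ⊗ₜ[ℝ] X j := fun j =>
    Int.cast_smul_eq_zsmul ℂ (m j) _
  simp [complexProj, Fintype.linearCombination_apply, h]

/-- The homomorphism `Π_ℂ : T^d_ℂ → E_ℂ/Q` induced by `π_ℂ`. -/
def torusProj (X : Fin d → E) (Q : AddSubgroup E) (hX : ∀ j, X j ∈ Q) : Torus d →+ Quasitorus Q :=
  QuotientAddGroup.map (intLattice d) (complexLattice Q) (complexProj X).toAddMonoidHom
    (intLattice_le_comap X Q hX)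

/-- The group `N_ℂ`, the kernel of `Π_ℂ`. -/
def kernelGroup (X : Fin d → E) (Q : AddSubgroup E) (hX : ∀ j, X j ∈ Q) : AddSubgroup (Torus d) :=
  (torusProj X Q hX).ker

/-! ### The orbit space attached to a polytope -/

/-- The set `ℂ^d_Δ`, the union over all faces `F` of `Δ` of the `T^d_ℂ`-orbits
`{z | z_j = 0 iff F lies on the j-th facet}`, with the action of `T^d_ℂ`. -/
def faceOrbits (Δ : Set (Module.Dual ℝ E)) (X : Fin d → E) (lam : Fin d → ℝ) :
    SubAddAction (Torus d) (Fin d → ℂ) where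
  carrier := {z | ∃ F, IsFace Δ F ∧ ∀ j, z j = 0 ↔ F ⊆ facet Δ X lam j}
  vadd_mem' := by
    rintro t z ⟨F, hF, h⟩
    refine ⟨F, hF, fun j => ?_⟩
    rw [torus_vadd_apply, ← h j]
    simp

/-- The orbit space `ℂ^d_Δ/N_ℂ` with its quotient topology. -/
abbrev ToricSpace (Δ : Set (Module.Dual ℝ E)) (X : Fin d → E) (lam : Fin d → ℝ)
    (Q : AddSubgroup E) (hX : ∀ j, X j ∈ Q) : Type :=
  AddAction.orbitRel.Quotient (kernelGroup X Q hX) (faceOrbits Δ X lam)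

/-- The class `[z]` of a point `z` of `ℂ^d_Δ`. -/
def ToricSpace.mk {Δ : Set (Module.Dual ℝ E)} {X : Fin d → E} {lam : Fin d → ℝ}
    {Q : AddSubgroup E} (hX : ∀ j, X j ∈ Q) (z : faceOrbits Δ X lam) :
    ToricSpace Δ X lam Q hX :=
  Quotient.mk (AddAction.orbitRel (kernelGroup X Q hX) (faceOrbits Δ X lam)) z

/-- For `I = {r 1, …, r n}`, the point of `ℂ^d` with coordinate `z i` at `r i` and coordinate `1` at
all `j ∉ I`. For `z = 0` this is the base point `z^μ`, in general it is `z^μ + z`. -/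
def slice {n : ℕ} (r : Fin n → Fin d) (z : Fin n → ℂ) : Fin d → ℂ :=
  Function.extend r z 1

/-- The discrete group `Γ_μ`, the intersection of `N_ℂ` with the stabilizer of `z^μ` in
`T^d_ℂ`. -/
def vertexGroup {n : ℕ} (X : Fin d → E) (Q : AddSubgroup E) (hX : ∀ j, X j ∈ Q)
    (r : Fin n → Fin d) : AddSubgroup (Torus d) :=
  AddAction.stabilizer (Torus d) (slice r 0) ⊓ kernelGroup X Q hX

/-- `c` is the chart `ℂ^n/Γ_μ → V_μ`, `[z] ↦ [z^μ + z]`, of `ℂ^d_Δ/N_ℂ` attached to the vertex `μ`.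
Here `r` enumerates the set `I` of facets through `μ`, which identifies `∏_{j ∈ I} ℂ e_j` with
`ℂ^n`; the group `Γ_μ` acts as a subgroup of `T^d_ℂ`; and `V_μ` consists of all `[z]` with
`z_j ≠ 0` for `j ∉ I`. -/
def IsVertexChart {n : ℕ} (Δ : Set (Module.Dual ℝ E)) (X : Fin d → E) (lam : Fin d → ℝ)
    (Q : AddSubgroup E) (hX : ∀ j, X j ∈ Q) (μ : Module.Dual ℝ E)
    (c : Chart n (ToricSpace Δ X lam Q hX)) : Prop :=
  ∃ r : Fin n → Fin d, Function.Injective r ∧ Set.range r = {j | μ (X j) = lam j} ∧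
    c.domain = ⊤ ∧
    (c.target : Set (ToricSpace Δ X lam Q hX)) =
      {m | ∃ z : faceOrbits Δ X lam, (∀ j, j ∉ Set.range r → (z : Fin d → ℂ) j ≠ 0) ∧
        m = ToricSpace.mk hX z} ∧
    (∃ θ : c.Γ ≃* Multiplicative (vertexGroup X Q hX r), ∀ (g : c.Γ) (z : c.domain),
      slice r ((g • z : c.domain) : Fin n → ℂ) =
        ((θ g).toAdd : Torus d) +ᵥ slice r (z : Fin n → ℂ)) ∧
    ∀ z : c.domain, ∃ h : slice r (z : Fin n → ℂ) ∈ faceOrbits Δ X lam,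
      c.toSpace z = ToricSpace.mk hX ⟨slice r z, h⟩

/-- The atlas of the quasifold structure `𝒜` on `ℂ^d_Δ/N_ℂ` contains one chart `ℂ^n/Γ_μ` for each
vertex `μ` of `Δ`, and these charts cover. -/
structure HasVertexCharts {n : ℕ} (Δ : Set (Module.Dual ℝ E)) (X : Fin d → E) (lam : Fin d → ℝ)
    (Q : AddSubgroup E) (hX : ∀ j, X j ∈ Q)
    (𝒜 : ComplexQuasifold n (ToricSpace Δ X lam Q hX)) : Prop where
  chart : ∀ μ, IsVertex Δ μ → ∃ c ∈ 𝒜.atlas, IsVertexChart Δ X lam Q hX μ c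
  cover : ∀ m, ∃ μ, IsVertex Δ μ ∧ ∃ c ∈ 𝒜.atlas, IsVertexChart Δ X lam Q hX μ c ∧ m ∈ c.target

/-- A holomorphic action of the complex quasitorus `E_ℂ/Q`, with the quasifold structure `𝒟`, on a
complex quasifold. -/
structure IsHolomorphicAction {n k : ℕ} {Q : AddSubgroup E} {M : Type*} [TopologicalSpace M]
    (𝒟 : ComplexQuasifold n (Quasitorus Q)) (𝒜 : ComplexQuasifold k M)
    (τ : Quasitorus Q × M → M) : Prop where
  add : ∀ a b m, τ (a + b, m) = τ (a, τ (b, m))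
  zero : ∀ m, τ (0, m) = m
  holomorphic : IsHolomorphicOnProd 𝒟 𝒜 𝒜 τ

end Torus

end Quasifold

end

/-! Combinatorics enters through one fact: simplicity makes exactly `n` facets meet in each vertex
(`IsVertex.ncard_activeSet`). Since the normals active at a vertex always span
(`IsVertex.span_eq_top`), they form a basis, without any rationality. Hence π_ℂ has a linear
section, `VertexFrame.lift`, supported on the `n` coordinates at the vertex.

This section produces the elements of N_ℂ that are needed. For `Y` in ℂ^d the difference `Y - lift
(π_ℂ Y)` is killed by π_ℂ, so it represents an element of N_ℂ, and away from the facets at the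
vertex it has the same coordinates as `Y`. With `Y` made of logarithms, N_ℂ moves every point whose
coordinates away from these facets are nonzero into the slice where they equal 1. Two slice points
are equivalent under N_ℂ exactly when they are under Γ_μ, and near the slice the normalization is
continuous, which makes the chart map open (`isOpenMap_toToric`). Elements of Γ_μ are classes of
lifts of elements of Q, so Γ_μ is countable; it acts freely where no coordinate vanishes.

An overlap of two vertex charts is the set where some coordinates are nonzero. Its universal cover
is ℂ^n, by exponentials in these coordinates, and there the change of charts becomes the explicit
entire map `transition`, whose inverse is the same map with the vertices exchanged. The charts cover
because every face of a bounded polyhedron contains a vertex (`IsFace.exists_isVertex`). Zorn's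
lemma extends them to a maximal atlas.

The torus action descends because N_ℂ is the kernel of Π_ℂ and the torus is commutative. In a vertex
chart it lifts to a diagonal action by exponentials of linear forms. The orbit of (1, …, 1) consists
of the classes with no zero coordinate; it is open, and it is dense in each chart. -/

noncomputable section

namespace Quasifold

/-! ### Polytopes given by inequalities -/

section Polyhedron

variable {E : Type*} [AddCommGroup E] [Module ℝ E] {d : ℕ} {Δ : Set (Module.Dual ℝ E)}
  {X : Fin d → E} {lam : Fin d → ℝ}

/-- The indices of the inequalities that are equalities at `μ`. -/
def activeSet (X : Fin d → E) (lam : Fin d → ℝ) (μ : Module.Dual ℝ E) : Set (Fin d) :=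
  {j | μ (X j) = lam j}

/-- Moving a nonnegative vector `a` along `b` until a further coordinate vanishes. -/
theorem exists_add_mul_eq_zero {ι : Type*} [Finite ι] (a b : ι → ℝ) (ha : ∀ j, 0 ≤ a j)
    (hab : ∀ j, a j = 0 → b j = 0) (hb : ∃ j, b j < 0) :
    ∃ t : ℝ, 0 < t ∧ (∀ j, 0 ≤ a j + t * b j) ∧ ∃ j, a j ≠ 0 ∧ a j + t * b j = 0 := by
  -- Ratio test: the first coordinate to vanish is the one that minimizes `a j / -b j` among the
  -- decreasing ones.
  obtain ⟨j, hj, hmin⟩ := Set.exists_min_image {j | b j < 0} (fun j => a j / -b j)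
    (Set.toFinite _) hb
  have hbj : b j < 0 := hj
  have haj : a j ≠ 0 := fun h => hbj.ne (hab j h)
  refine ⟨a j / -b j, div_pos ((ha j).lt_of_ne' haj) (neg_pos.2 hbj), fun i => ?_, j, haj, ?_⟩
  · rcases lt_or_ge (b i) 0 with h | h
    · have h1 := (le_div_iff₀ (neg_pos.2 h)).1 (hmin i h)
      linarith
    · have := mul_nonneg (div_nonneg (ha j) (neg_pos.2 hbj).le) h
      linarith [ha i]
  · field_simp [hbj.ne]
    ring

theorem exists_dual_ne_zero_of_span_ne_top {S : Set E} (h : Submodule.span ℝ S ≠ ⊤) :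
    ∃ w : Module.Dual ℝ E, w ≠ 0 ∧ ∀ s ∈ S, w s = 0 := by
  obtain ⟨w, hw, hle⟩ := Submodule.exists_le_ker_of_lt_top _ (lt_top_iff_ne_top.2 h)
  exact ⟨w, hw, fun s hs => hle (Submodule.subset_span hs)⟩

theorem dual_eq_of_eqOn_span {S : Set E} (h : Submodule.span ℝ S = ⊤) {v w : Module.Dual ℝ E}
    (hvw : ∀ s ∈ S, v s = w s) : v = w :=
  LinearMap.ext_on h hvw

theorem mem_iff_of_eq_iInter (hΔ : Δ = ⋂ j, {μ | lam j ≤ μ (X j)}) {ν : Module.Dual ℝ E} :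
    ν ∈ Δ ↔ ∀ j, lam j ≤ ν (X j) := by
  rw [hΔ]; simp

/-- Active inequalities survive because `w` is nonnegative on their normals; the finitely many
others are strict at `μ` and survive for small `ε` by continuity. -/
theorem exists_pos_add_smul_mem (hΔ : Δ = ⋂ j, {μ | lam j ≤ μ (X j)}) {μ : Module.Dual ℝ E}
    (hμ : μ ∈ Δ) {w : Module.Dual ℝ E} (hw : ∀ j ∈ activeSet X lam μ, 0 ≤ w (X j)) :
    ∃ ε : ℝ, 0 < ε ∧ μ + ε • w ∈ Δ := by
  have key : ∀ j, ∀ᶠ ε in nhdsWithin (0 : ℝ) (Set.Ioi 0), lam j ≤ (μ + ε • w) (X j) := by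
    intro j
    by_cases hj : μ (X j) = lam j
    · filter_upwards [self_mem_nhdsWithin] with ε hε
      have := mul_nonneg (le_of_lt (Set.mem_Ioi.1 hε)) (hw j hj)
      simp [hj, this]
    · have hlt : lam j < μ (X j) := ((mem_iff_of_eq_iInter hΔ).1 hμ j).lt_of_ne' hj
      have hc : Continuous fun ε : ℝ => (μ + ε • w) (X j) := by
        simp only [LinearMap.add_apply, LinearMap.smul_apply, smul_eq_mul]
        fun_prop
      have := (hc.tendsto 0).eventually (lt_mem_nhds (a := lam j) (by simpa using hlt))
      exact (this.filter_mono nhdsWithin_le_nhds).mono fun _ h => h.le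
  obtain ⟨ε, h, hε⟩ := ((Filter.eventually_all.2 key).and self_mem_nhdsWithin).exists
  exact ⟨ε, hε, (mem_iff_of_eq_iInter hΔ).2 h⟩

/-- The part of `Δ` where some inequalities are equalities is a face. -/
theorem isFace_setOf_active (hΔ : Δ = ⋂ j, {μ | lam j ≤ μ (X j)}) {μ : Module.Dual ℝ E}
    (hμ : μ ∈ Δ) {J : Set (Fin d)} (hJ : J ⊆ activeSet X lam μ) :
    IsFace Δ {ν ∈ Δ | ∀ j ∈ J, ν (X j) = lam j} := by
  classical
  -- The sum of the normals in `J` exposes the face: its minimum is the sum of the `lam j`, attained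
  -- at `μ`, and equality of the sums forces equality term by term.
  refine ⟨⟨μ, hμ, fun j hj => hJ hj⟩, ∑ j ∈ J.toFinset, X j, ?_⟩
  have hsum : ∀ ν ∈ Δ, ∑ j ∈ J.toFinset, lam j ≤ ν (∑ j ∈ J.toFinset, X j) := by
    intro ν hν
    rw [map_sum]
    exact Finset.sum_le_sum fun j _ => (mem_iff_of_eq_iInter hΔ).1 hν j
  ext ν
  refine and_congr_right fun hν => ⟨fun h ξ hξ => ?_, fun h => ?_⟩
  · refine le_trans (le_of_eq ?_) (hsum ξ hξ)
    rw [map_sum]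
    exact Finset.sum_congr rfl fun j hj => h j (by simpa using hj)
  · have h1 : ∑ j ∈ J.toFinset, ν (X j) ≤ ∑ j ∈ J.toFinset, lam j := by
      have := h μ hμ
      rw [map_sum, map_sum] at this
      exact this.trans (le_of_eq (Finset.sum_congr rfl fun j hj => hJ (by simpa using hj)))
    have h2 := (Finset.sum_eq_sum_iff_of_le
      (fun j (_ : j ∈ J.toFinset) => (mem_iff_of_eq_iInter hΔ).1 hν j)).1
      (le_antisymm (Finset.sum_le_sum fun j _ => (mem_iff_of_eq_iInter hΔ).1 hν j) h1)
    exact fun j hj => (h2 j (by simpa using hj)).symm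

/-! ### Vertices, edges and active normals -/

theorem IsVertex.mem {μ : Module.Dual ℝ E} (h : IsVertex Δ μ) : μ ∈ Δ := by
  obtain ⟨-, x, hx⟩ := h
  have : μ ∈ ({μ} : Set _) := rfl
  rw [hx] at this
  exact this.1

theorem isVertex_of_span_eq_top (hΔ : Δ = ⋂ j, {μ | lam j ≤ μ (X j)}) {μ : Module.Dual ℝ E}
    (hμ : μ ∈ Δ) (hs : Submodule.span ℝ (X '' activeSet X lam μ) = ⊤) : IsVertex Δ μ := by
  have h := isFace_setOf_active hΔ hμ subset_rfl
  have e : {ν ∈ Δ | ∀ j ∈ activeSet X lam μ, ν (X j) = lam j} = {μ} := by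
    ext ν
    constructor
    · rintro ⟨-, hν⟩
      refine dual_eq_of_eqOn_span hs ?_
      rintro _ ⟨j, hj, rfl⟩
      exact (hν j hj).trans (Eq.symm hj)
    · rintro rfl
      exact ⟨hμ, fun j hj => hj⟩
  rwa [e] at h

/-- If the active normals did not span, some `w ≠ 0` would vanish on them, and one could move from
`μ` inside `Δ` in both directions `w` and `-w`. The linear function exposing `μ` would be constant
along `w`, hence minimal at a second point. -/
theorem IsVertex.span_eq_top (hΔ : Δ = ⋂ j, {μ | lam j ≤ μ (X j)}) {μ : Module.Dual ℝ E}
    (h : IsVertex Δ μ) : Submodule.span ℝ (X '' activeSet X lam μ) = ⊤ := by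
  by_contra hs
  obtain ⟨w, hw0, hw⟩ := exists_dual_ne_zero_of_span_ne_top hs
  have hw' : ∀ j ∈ activeSet X lam μ, w (X j) = 0 := fun j hj => hw _ ⟨j, hj, rfl⟩
  obtain ⟨ε, hε, h1⟩ := exists_pos_add_smul_mem hΔ h.mem (w := w) fun j hj => (hw' j hj).ge
  obtain ⟨δ, hδ, h2⟩ := exists_pos_add_smul_mem hΔ h.mem (w := -w) fun j hj => by simp [hw' j hj]
  obtain ⟨-, x, hx⟩ := h
  have hμ : μ ∈ {μ ∈ Δ | ∀ ν ∈ Δ, μ x ≤ ν x} := hx ▸ rfl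
  have a1 := hμ.2 _ h1
  have a2 := hμ.2 _ h2
  simp only [LinearMap.add_apply, LinearMap.smul_apply, LinearMap.neg_apply, smul_eq_mul,
    le_add_iff_nonneg_right] at a1 a2
  have hwx : w x = 0 := by
    have b1 := nonneg_of_mul_nonneg_right a1 hε
    have b2 := nonneg_of_mul_nonneg_right a2 hδ
    linarith
  have h3 : μ + ε • w ∈ ({μ} : Set _) := by
    rw [hx]
    exact ⟨h1, fun ν hν => by simpa [hwx] using hμ.2 ν hν⟩
  have h4 : ε • w = 0 := by simpa using h3
  exact hw0 ((smul_eq_zero.1 h4).resolve_left hε.ne')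

/-- This is boundedness of the polytope: if `w` were nonnegative on all normals, `Δ` would contain
the ray from `ν` along `w`, whereas every linear function is bounded on the convex hull of a finite
set. -/
theorem exists_neg_of_ne_zero (hΔ : Δ = ⋂ j, {μ | lam j ≤ μ (X j)}) {s : Finset (Module.Dual ℝ E)}
    (hs : Δ = convexHull ℝ (s : Set (Module.Dual ℝ E))) {ν : Module.Dual ℝ E} (hν : ν ∈ Δ)
    {w : Module.Dual ℝ E} (hw : w ≠ 0) : ∃ j, w (X j) < 0 := by
  by_contra! hn
  obtain ⟨y, hy⟩ : ∃ y, w y ≠ 0 := by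
    by_contra! h
    exact hw (LinearMap.ext h)
  obtain ⟨y, hy⟩ : ∃ y, 0 < w y := by
    rcases lt_or_gt_of_ne hy with h | h
    · exact ⟨-y, by simpa using h⟩
    · exact ⟨y, h⟩
  obtain ⟨B, hB⟩ := ((s.finite_toSet).image fun ξ : Module.Dual ℝ E => ξ y).bddAbove
  have hsub : Δ ⊆ {ξ : Module.Dual ℝ E | ξ y ≤ B} := by
    rw [hs]
    refine convexHull_min (fun ξ hξ => hB ⟨ξ, hξ, rfl⟩) ?_
    exact convex_halfSpace_le (f := fun ξ : Module.Dual ℝ E => ξ y)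
      (IsLinearMap.mk (fun _ _ => rfl) fun _ _ => rfl) B
  have hray : ∀ t : ℝ, 0 ≤ t → ν y + t * w y ≤ B := by
    intro t ht
    have : ν + t • w ∈ Δ := by
      rw [mem_iff_of_eq_iInter hΔ]
      intro j
      have h1 := (mem_iff_of_eq_iInter hΔ).1 hν j
      have h2 := mul_nonneg ht (hn j)
      simp only [LinearMap.add_apply, LinearMap.smul_apply, smul_eq_mul]
      linarith
    simpa using hsub this
  have h0 := hray 0 le_rfl
  -- At this time the value at `y` would be `B + 1`.
  have h1 := hray ((B - ν y + 1) / w y) (div_nonneg (by linarith) hy.le)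
  rw [div_mul_cancel₀ _ hy.ne'] at h1
  linarith

/-- Every nonempty face of a polytope contains a vertex. -/
theorem IsFace.exists_isVertex (hΔ : Δ = ⋂ j, {μ | lam j ≤ μ (X j)})
    {s : Finset (Module.Dual ℝ E)} (hs : Δ = convexHull ℝ (s : Set (Module.Dual ℝ E)))
    {F : Set (Module.Dual ℝ E)} (hF : IsFace Δ F) : ∃ μ ∈ F, IsVertex Δ μ := by
  obtain ⟨⟨ν₀, hν₀⟩, x, hx⟩ := hF
  -- Induction on the number of inactive inequalities: unless the active normals span, move inside
  -- `F` along a direction on which they vanish until one more inequality becomes active.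
  have key : ∀ k : ℕ, ∀ ν ∈ F, (activeSet X lam ν)ᶜ.ncard = k → ∃ μ ∈ F, IsVertex Δ μ := by
    intro k
    induction k using Nat.strong_induction_on with
    | _ k ih =>
      intro ν hν hk
      have hν' := hν
      rw [hx] at hν'
      by_cases hsp : Submodule.span ℝ (X '' activeSet X lam ν) = ⊤
      · exact ⟨ν, hν, isVertex_of_span_eq_top hΔ hν'.1 hsp⟩
      obtain ⟨w, hw0, hw⟩ := exists_dual_ne_zero_of_span_ne_top hsp
      have hw' : ∀ j ∈ activeSet X lam ν, w (X j) = 0 := fun j hj => hw _ ⟨j, hj, rfl⟩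
      obtain ⟨ε, hε, h1⟩ := exists_pos_add_smul_mem hΔ hν'.1 (w := w) fun j hj => (hw' j hj).ge
      obtain ⟨δ, hδ, h2⟩ := exists_pos_add_smul_mem hΔ hν'.1 (w := -w) fun j hj => by
        simp [hw' j hj]
      have a1 := hν'.2 _ h1
      have a2 := hν'.2 _ h2
      simp only [LinearMap.add_apply, LinearMap.smul_apply, LinearMap.neg_apply, smul_eq_mul,
        le_add_iff_nonneg_right] at a1 a2
      have hwx : w x = 0 := by
        have b1 := nonneg_of_mul_nonneg_right a1 hε
        have b2 := nonneg_of_mul_nonneg_right a2 hδ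
        linarith
      obtain ⟨t, -, ht, i, hi, hi0⟩ := exists_add_mul_eq_zero (fun j => ν (X j) - lam j)
        (fun j => w (X j)) (fun j => sub_nonneg.2 ((mem_iff_of_eq_iInter hΔ).1 hν'.1 j))
        (fun j hj => hw' j (sub_eq_zero.1 hj)) (exists_neg_of_ne_zero hΔ hs hν'.1 hw0)
      have hmem : ν + t • w ∈ Δ := by
        rw [mem_iff_of_eq_iInter hΔ]
        intro j
        have := ht j
        simp only [LinearMap.add_apply, LinearMap.smul_apply, smul_eq_mul]
        linarith
      have hmemF : ν + t • w ∈ F := by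
        rw [hx]
        exact ⟨hmem, fun ξ hξ => by simpa [hwx] using hν'.2 ξ hξ⟩
      refine ih _ ?_ _ hmemF rfl
      rw [← hk]
      refine Set.ncard_lt_ncard ⟨?_, fun hsub => ?_⟩ (Set.toFinite _)
      · refine Set.compl_subset_compl.2 fun j hj => ?_
        have hj' : ν (X j) = lam j := hj
        simp [activeSet, hw' j hj, hj']
      · have : i ∈ (activeSet X lam ν)ᶜ := fun h => hi (sub_eq_zero.2 h)
        refine hsub this ?_
        simp only [activeSet, Set.mem_ofPred_eq, LinearMap.add_apply, LinearMap.smul_apply,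
          smul_eq_mul]
        linarith
  exact key _ ν₀ hν₀ rfl

theorem smul_mem_span_nnreal {M : Type*} [AddCommGroup M] [Module ℝ M] {S : Set M} {t : ℝ}
    (ht : 0 ≤ t) {v : M} (hv : v ∈ Submodule.span NNReal S) : t • v ∈ Submodule.span NNReal S :=
  Submodule.smul_mem _ (⟨t, ht⟩ : NNReal) hv

/-- The tangent cone of a polytope at a vertex is generated by the edges. -/
theorem IsVertex.mem_span_edges (hΔ : Δ = ⋂ j, {μ | lam j ≤ μ (X j)}) {μ : Module.Dual ℝ E}
    (hμ : IsVertex Δ μ) {e : {F | IsFace Δ F ∧ dim F = 1 ∧ μ ∈ F} → Module.Dual ℝ E}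
    (he0 : ∀ F, e F ≠ 0) (he : ∀ F, μ + e F ∈ F.1) {v : Module.Dual ℝ E}
    (hv : ∀ j ∈ activeSet X lam μ, 0 ≤ v (X j)) :
    v ∈ Submodule.span NNReal (Set.range e) := by
  have hsp := hμ.span_eq_top hΔ
  have hμΔ := hμ.mem
  set I := activeSet X lam μ with hI
  -- Induction on the number of active normals on which `v` does not vanish.
  have key : ∀ k : ℕ, ∀ v : Module.Dual ℝ E, (∀ j ∈ I, 0 ≤ v (X j)) →
      {j ∈ I | v (X j) ≠ 0}.ncard = k → v ∈ Submodule.span NNReal (Set.range e) := by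
    intro k
    induction k using Nat.strong_induction_on with
    | _ k ih =>
      intro v hv hk
      by_cases hv0 : v = 0
      · rw [hv0]; exact zero_mem _
      obtain ⟨j₀, hj₀, hvj₀⟩ : ∃ j ∈ I, 0 < v (X j) := by
        by_contra! h
        refine hv0 (dual_eq_of_eqOn_span hsp ?_)
        rintro _ ⟨j, hj, rfl⟩
        exact le_antisymm (h j hj) (hv j hj)
      -- Either `v` spans an extreme ray, and then the face cut out by the normals on which `v`
      -- vanishes is an edge in the direction `v`, or `v` lies between two vectors of the cone that
      -- vanish on more normals.
      by_cases hL : ∀ w : Module.Dual ℝ E, (∀ j ∈ I, v (X j) = 0 → w (X j) = 0) → ∃ c : ℝ, w = c • v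
      · let J : Set (Fin d) := {j ∈ I | v (X j) = 0}
        have hJI : J ⊆ I := fun j hj => hj.1
        let F : Set (Module.Dual ℝ E) := {ν ∈ Δ | ∀ j ∈ J, ν (X j) = lam j}
        have hμF : μ ∈ F := ⟨hμΔ, fun j hj => hj.1⟩
        have hFv : ∀ ν ∈ F, ∃ c : ℝ, ν - μ = c • v := by
          intro ν hν
          refine hL _ fun j hj hj0 => ?_
          have h1 : ν (X j) = lam j := hν.2 j ⟨hj, hj0⟩
          have h2 : μ (X j) = lam j := hj
          simp [h1, h2]
        have hspan : vectorSpan ℝ F = Submodule.span ℝ {v} := by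
          rw [vectorSpan_eq_span_vsub_set_right ℝ hμF]
          apply le_antisymm
          · rw [Submodule.span_le]
            rintro _ ⟨ν, hν, rfl⟩
            obtain ⟨c, hc⟩ := hFv ν hν
            exact Submodule.mem_span_singleton.2 ⟨c, hc.symm⟩
          · rw [Submodule.span_singleton_le_iff_mem]
            obtain ⟨ε, hε, hmem⟩ := exists_pos_add_smul_mem hΔ hμΔ hv
            have hm : ε • v ∈ Submodule.span ℝ ((fun x => x -ᵥ μ) '' F) := by
              refine Submodule.subset_span ⟨μ + ε • v, ⟨hmem, fun j hj => ?_⟩, by simp⟩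
              have h1 : v (X j) = 0 := hj.2
              have h2 : μ (X j) = lam j := hj.1
              simp [h1, h2]
            exact (Submodule.smul_mem_iff _ hε.ne').1 hm
        let F' : {F | IsFace Δ F ∧ dim F = 1 ∧ μ ∈ F} :=
          ⟨F, isFace_setOf_active hΔ hμΔ hJI, by
            rw [dim, hspan, finrank_span_singleton hv0], hμF⟩
        obtain ⟨c, hc⟩ := hFv _ (he F')
        rw [add_sub_cancel_left] at hc
        have hc0 : 0 < c := by
          have h1 : 0 ≤ e F' (X j₀) := by
            have h2 := (mem_iff_of_eq_iInter hΔ).1 (he F').1 j₀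
            have h3 : μ (X j₀) = lam j₀ := hj₀
            rw [LinearMap.add_apply, h3] at h2
            linarith
          rw [hc, LinearMap.smul_apply, smul_eq_mul] at h1
          refine (nonneg_of_mul_nonneg_left h1 hvj₀).lt_of_ne fun h => he0 F' ?_
          rw [hc, ← h, zero_smul]
        have : v = c⁻¹ • e F' := by rw [hc, inv_smul_smul₀ hc0.ne']
        rw [this]
        exact smul_mem_span_nnreal (inv_pos.2 hc0).le (Submodule.subset_span ⟨F', rfl⟩)
      · push Not at hL
        obtain ⟨w₀, hw₀, hw₀v⟩ := hL
        classical
        -- `h` is positive on the nonzero vectors of the cone. A direction `w ≠ 0` with `w h = 0` is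
        -- therefore negative on some active normal, and so is `-w`: moving from `v` either way
        -- reaches the boundary of the cone.
        let h : E := ∑ j ∈ I.toFinset, X j
        have hvh : 0 < v h := by
          rw [map_sum]
          exact Finset.sum_pos' (fun j hj => hv j (by simpa using hj))
            ⟨j₀, by simpa using hj₀, hvj₀⟩
        obtain ⟨w, hwL, hw0, hwh⟩ : ∃ w : Module.Dual ℝ E,
            (∀ j ∈ I, v (X j) = 0 → w (X j) = 0) ∧ w ≠ 0 ∧ w h = 0 := by
          refine ⟨w₀ - (w₀ h / v h) • v, fun j hj h0 => by simp [hw₀ j hj h0, h0],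
            fun h0 => hw₀v _ (sub_eq_zero.1 h0), ?_⟩
          simp [hvh.ne']
        have hex : ∀ w : Module.Dual ℝ E, w ≠ 0 → w h = 0 → ∃ j : I, w (X j) < 0 := by
          intro w hw0 hwh
          by_contra! hn
          rw [map_sum, Finset.sum_eq_zero_iff_of_nonneg
            (fun j hj => hn ⟨j, by simpa using hj⟩)] at hwh
          refine hw0 (dual_eq_of_eqOn_span hsp ?_)
          rintro _ ⟨j, hj, rfl⟩
          exact hwh j (by simpa using hj)
        have step : ∀ w : Module.Dual ℝ E, (∀ j ∈ I, v (X j) = 0 → w (X j) = 0) → w ≠ 0 →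
            w h = 0 → ∃ t : ℝ, 0 < t ∧ v + t • w ∈ Submodule.span NNReal (Set.range e) := by
          intro w hwL hw0 hwh
          obtain ⟨t, ht0, ht, i, hi, hi0⟩ := exists_add_mul_eq_zero (fun j : I => v (X j))
            (fun j : I => w (X j)) (fun j => hv j j.2) (fun j hj => hwL j j.2 hj) (hex w hw0 hwh)
          refine ⟨t, ht0, ih _ ?_ (v + t • w) (fun j hj => by simpa using ht ⟨j, hj⟩) rfl⟩
          rw [← hk]
          refine Set.ncard_lt_ncard ⟨fun j hj => ⟨hj.1, fun h0 => hj.2 ?_⟩, fun hsub => ?_⟩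
            (Set.toFinite _)
          · simp [h0, hwL j hj.1 h0]
          · exact (hsub (show (i : Fin d) ∈ {j ∈ I | v (X j) ≠ 0} from ⟨i.2, hi⟩)).2
              (by simpa using hi0)
        obtain ⟨t, ht, h1⟩ := step w hwL hw0 hwh
        obtain ⟨s, hs, h2⟩ := step (-w) (fun j hj h0 => by simp [hwL j hj h0]) (neg_ne_zero.2 hw0)
          (by simp [hwh])
        have hst : 0 < s + t := add_pos hs ht
        -- The weights are chosen so that the two multiples of `w` cancel.
        have : v = (s / (s + t)) • (v + t • w) + (t / (s + t)) • (v + s • (-w)) := by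
          have e1 : v = ((s / (s + t)) + (t / (s + t))) • v := by
            rw [← add_div, div_self hst.ne', one_smul]
          conv_lhs => rw [e1]
          module
        rw [this]
        exact add_mem (smul_mem_span_nnreal (div_pos hs hst).le h1)
          (smul_mem_span_nnreal (div_pos ht hst).le h2)
  exact key _ v hv rfl

/-- Exactly `n` facets of a simple `n`-dimensional polytope meet in each vertex. -/
theorem IsVertex.ncard_activeSet [FiniteDimensional ℝ E] {n : ℕ} (hn : Module.finrank ℝ E = n)
    (hΔ : IsSimplePolytope n Δ) (hX : AreInwardNormals n Δ X lam) {μ : Module.Dual ℝ E}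
    (hμ : IsVertex Δ μ) : (activeSet X lam μ).ncard = n := by
  have hsp := hμ.span_eq_top hX.eq_inter
  have hμΔ := hμ.mem
  set I := activeSet X lam μ with hI
  -- For `≤`, the facets through `μ` inject into the `n` edges at `μ`, each facet being sent to the
  -- one edge that leaves it. For `≥`, the active normals span.
  apply le_antisymm
  · let T : Set (Set (Module.Dual ℝ E)) := {F | IsFace Δ F ∧ dim F = 1 ∧ μ ∈ F}
    have hT : T.encard = n := hΔ.simple μ hμ
    have hTfin : T.Finite := Set.finite_of_encard_eq_coe hT
    have hTn : T.ncard = n := by rw [Set.ncard, hT]; rfl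
    have hex : ∀ F : T, ∃ v : Module.Dual ℝ E, v ≠ 0 ∧ μ + v ∈ F.1 := by
      rintro ⟨F, hF, hF1, hμF⟩
      by_contra! h
      have : F = {μ} := by
        refine Set.eq_singleton_iff_unique_mem.2 ⟨hμF, fun ν hν => ?_⟩
        by_contra hne
        exact h (ν - μ) (sub_ne_zero.2 hne) (by simpa using hν)
      rw [this, dim, vectorSpan_singleton] at hF1
      simp at hF1
    choose e he0 he using hex
    have hFΔ : ∀ F : T, F.1 ⊆ Δ := by
      intro F
      obtain ⟨x, hx⟩ := F.2.1.2
      exact fun ν hν => (hx.le hν).1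
    have heI : ∀ F : T, ∀ j ∈ I, 0 ≤ e F (X j) := by
      intro F j hj
      have h1 := (mem_iff_of_eq_iInter hX.eq_inter).1 (hFΔ F (he F)) j
      have h2 : μ (X j) = lam j := hj
      rw [LinearMap.add_apply, h2] at h1
      linarith
    have : Fintype T := hTfin.fintype
    have hcomb : ∀ ν ∈ Δ, ∃ c : T → NNReal, ν - μ = ∑ F, c F • e F := by
      intro ν hν
      have := hμ.mem_span_edges hX.eq_inter he0 he (v := ν - μ) fun j hj => by
        have h1 := (mem_iff_of_eq_iInter hX.eq_inter).1 hν j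
        have h2 : μ (X j) = lam j := hj
        rw [LinearMap.sub_apply, h2]
        linarith
      obtain ⟨c, hc⟩ := (Submodule.mem_span_range_iff_exists_fun NNReal).1 this
      exact ⟨c, hc.symm⟩
    choose! c hc using hcomb
    -- `ν (X j) - lam j` is a sum of nonnegative terms, one for each edge, so it vanishes only if no
    -- edge that leaves the facet is used.
    have hfacet : ∀ j ∈ I, ∀ ν ∈ Δ, (ν ∈ facet Δ X lam j ↔ ∀ F, e F (X j) ≠ 0 → c ν F = 0) := by
      intro j hj ν hν
      have h2 : μ (X j) = lam j := hj
      have h3 : ν (X j) - lam j = ∑ F, (c ν F : ℝ) * e F (X j) := by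
        have := congrArg (fun v : Module.Dual ℝ E => v (X j)) (hc ν hν)
        simpa [h2, NNReal.smul_def, LinearMap.sum_apply] using this
      have h4 : ν ∈ facet Δ X lam j ↔ ν (X j) - lam j = 0 := by
        rw [sub_eq_zero]
        exact and_iff_right hν
      rw [h4, h3]
      refine (Finset.sum_eq_zero_iff_of_nonneg
        fun F _ => mul_nonneg (NNReal.coe_nonneg _) (heI F j hj)).trans ?_
      refine forall_congr' fun F => ?_
      rw [mul_eq_zero, NNReal.coe_eq_zero]
      simp only [Finset.mem_univ, true_implies]
      tauto
    have hμfacet : ∀ j ∈ I, μ ∈ facet Δ X lam j := fun j hj => ⟨hμΔ, hj⟩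
    -- The facet has dimension `n - 1` and is spanned by the edges it contains, so at least `n - 1`
    -- of the `n` edges lie in it.
    have hone : ∀ j ∈ I, {F : T | e F (X j) ≠ 0}.ncard ≤ 1 := by
      intro j hj
      have hle : vectorSpan ℝ (facet Δ X lam j) ≤
          Submodule.span ℝ (e '' {F : T | e F (X j) = 0}) := by
        rw [vectorSpan_eq_span_vsub_set_right ℝ (hμfacet j hj), Submodule.span_le]
        rintro _ ⟨ν, hν, rfl⟩
        have h1 := (hfacet j hj ν hν.1).1 hν
        simp only [vsub_eq_sub, SetLike.mem_coe]
        rw [hc ν hν.1]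
        refine sum_mem fun F _ => ?_
        by_cases hF : e F (X j) = 0
        · rw [NNReal.smul_def]
          exact Submodule.smul_mem _ _ (Submodule.subset_span ⟨F, hF, rfl⟩)
        · rw [h1 F hF, zero_smul]
          exact zero_mem _
      have h1 : dim (facet Δ X lam j) ≤ {F : T | e F (X j) = 0}.ncard := by
        refine (Submodule.finrank_mono hle).trans ?_
        classical
        have := finrank_span_le_card (R := ℝ) (e '' {F : T | e F (X j) = 0})
        rw [← Set.ncard_eq_toFinset_card'] at this
        exact this.trans (Set.ncard_image_le (Set.toFinite _))
      have h2 := hX.codim_one j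
      have h3 : {F : T | e F (X j) = 0}.ncard + {F : T | e F (X j) ≠ 0}.ncard = n := by
        have := Set.ncard_add_ncard_compl {F : T | e F (X j) = 0} (Set.toFinite _)
          (Set.toFinite _)
        rw [Nat.card_coe_set_eq, hTn] at this
        exact this
      omega
    -- Otherwise the facet would be all of `Δ`, which has the wrong dimension.
    have hnon : ∀ j : I, ∃ F : T, e F (X j) ≠ 0 := by
      intro j
      by_contra! h
      have h1 : facet Δ X lam j = Δ := by
        refine Set.Subset.antisymm (fun ν hν => hν.1) fun ν hν => ?_
        exact (hfacet j j.2 ν hν).2 fun F hF => absurd (h F) hF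
      have h2 := hX.codim_one j
      rw [h1, hΔ.dim_eq] at h2
      omega
    choose f hf using hnon
    have huniq : ∀ (j : I) F, e F (X j) ≠ 0 ↔ F = f j := by
      intro j F
      refine ⟨fun h => ?_, fun h => h ▸ hf j⟩
      exact (Set.ncard_le_one (Set.toFinite _)).1 (hone j j.2) F h (f j) (hf j)
    -- By `hfacet` a facet is determined by the edge that leaves it, and different indices have
    -- different facets.
    have hinj : Function.Injective f := by
      intro j i hji
      refine Subtype.ext (hX.injective ?_)
      ext ν
      by_cases hν : ν ∈ Δ
      · rw [hfacet j j.2 ν hν, hfacet i i.2 ν hν]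
        simp only [huniq, hji]
      · exact ⟨fun h => absurd h.1 hν, fun h => absurd h.1 hν⟩
    calc I.ncard ≤ T.ncard := Nat.card_le_card_of_injective f hinj
      _ = n := hTn
  · classical
    have h1 := finrank_span_le_card (R := ℝ) (X '' I)
    rw [hsp, finrank_top, hn, ← Set.ncard_eq_toFinset_card'] at h1
    exact h1.trans (Set.ncard_image_le (Set.toFinite _))

/-- An enumeration of the facets through a vertex of a simple polytope yields a basis of normals. -/
theorem IsVertex.exists_basis [FiniteDimensional ℝ E] {n : ℕ} (hn : Module.finrank ℝ E = n)
    (hX : AreInwardNormals n Δ X lam) {μ : Module.Dual ℝ E}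
    (hμ : IsVertex Δ μ) {r : Fin n → Fin d} (hr : Set.range r = activeSet X lam μ) :
    ∃ B : Module.Basis (Fin n) ℝ E, ∀ i, B i = X (r i) := by
  have h : ⊤ ≤ Submodule.span ℝ (Set.range (X ∘ r)) := by
    rw [Set.range_comp, hr, hμ.span_eq_top hX.eq_inter]
  exact ⟨basisOfTopLeSpanOfCardEqFinrank (X ∘ r) h (by simp [hn]), fun i => by simp⟩

theorem IsVertex.exists_enumeration [FiniteDimensional ℝ E] {n : ℕ} (hn : Module.finrank ℝ E = n)
    (hΔ : IsSimplePolytope n Δ) (hX : AreInwardNormals n Δ X lam) {μ : Module.Dual ℝ E}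
    (hμ : IsVertex Δ μ) :
    ∃ r : Fin n → Fin d, Function.Injective r ∧ Set.range r = activeSet X lam μ := by
  have h := hμ.ncard_activeSet hn hΔ hX
  rw [← Nat.card_coe_set_eq] at h
  let f := (Finite.equivFinOfCardEq h).symm
  exact ⟨fun i => f i, Subtype.val_injective.comp f.injective, by
    rw [Set.range_comp' Subtype.val f, f.surjective.range_eq, Set.image_univ, Subtype.range_coe]⟩

/-- Any set of facets through a vertex whose normals form a basis intersects in a face that lies on
no other facet. -/
theorem exists_isFace_iff_mem {n : ℕ}
    (hΔ : Δ = ⋂ j, {μ | lam j ≤ μ (X j)}) {μ : Module.Dual ℝ E} (hμ : μ ∈ Δ)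
    {r : Fin n → Fin d} (hr : Set.range r = activeSet X lam μ)
    (B : Module.Basis (Fin n) ℝ E) (hB : ∀ i, B i = X (r i)) {J : Set (Fin d)}
    (hJ : J ⊆ Set.range r) :
    ∃ F, IsFace Δ F ∧ ∀ j, j ∈ J ↔ F ⊆ facet Δ X lam j := by
  refine ⟨_, isFace_setOf_active hΔ hμ (hr ▸ hJ), fun j =>
    ⟨fun hj ν hν => ⟨hν.1, hν.2 j hj⟩, fun hsub => ?_⟩⟩
  by_contra hj
  have hμj : μ (X j) = lam j := (hsub ⟨hμ, fun i hi => hr.le (hJ hi)⟩).2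
  obtain ⟨i, rfl⟩ : j ∈ Set.range r := hr.ge hμj
  have hinj : Function.Injective r := fun a b hab => B.injective (by rw [hB, hB, hab])
  have hcoord : ∀ k, B.coord i (X (r k)) = if k = i then 1 else 0 := by
    intro k
    rw [← hB, Module.Basis.coord_apply, Module.Basis.repr_self, Finsupp.single_apply]
  -- The dual basis vector at `i` is an inward direction that leaves the facet `r i` and stays on
  -- all other facets through `μ`.
  obtain ⟨ε, hε, hmem⟩ := exists_pos_add_smul_mem hΔ hμ (w := B.coord i) fun k hk => by
    obtain ⟨k, rfl⟩ := hr.ge hk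
    rw [hcoord]
    split_ifs <;> norm_num
  have h1 := (hsub (show μ + ε • B.coord i ∈ {ν ∈ Δ | ∀ j ∈ J, ν (X j) = lam j} from
    ⟨hmem, fun k hk => ?_⟩)).2
  · rw [LinearMap.add_apply, LinearMap.smul_apply, hcoord, hμj] at h1
    simp [hε.ne'] at h1
  · have hk' : μ (X k) = lam k := hr.le (hJ hk)
    obtain ⟨k, rfl⟩ := hJ hk
    have : k ≠ i := by rintro rfl; exact hj hk
    rw [LinearMap.add_apply, LinearMap.smul_apply, hcoord, if_neg this, hk']
    simp

end Polyhedron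

/-! ### Holomorphic maps between open subsets -/

section Manifold

variable {𝕜 : Type*} [NontriviallyNormedField 𝕜] {F : Type*} [NormedAddCommGroup F]
  [NormedSpace 𝕜 F] {H : Type*} [TopologicalSpace H] {I : ModelWithCorners 𝕜 F H}
  {M : Type*} [TopologicalSpace M] [ChartedSpace H M]
  {F' : Type*} [NormedAddCommGroup F'] [NormedSpace 𝕜 F'] {H' : Type*} [TopologicalSpace H']
  {I' : ModelWithCorners 𝕜 F' H'} {M' : Type*} [TopologicalSpace M'] [ChartedSpace H' M']

theorem mdifferentiable_subtypeVal {U : Opens M} :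
    MDifferentiable I I (Subtype.val : U → M) :=
  (contMDiff_subtype_val (n := 1)).mdifferentiable one_ne_zero

theorem mdifferentiable_subtypeVal_comp_iff {U : Opens M'} {f : M → U} :
    MDifferentiable I I' (fun x => (f x : M')) ↔ MDifferentiable I I' f :=
  forall_congr' fun x => ChartedSpace.liftPropWithinAt_subtypeVal_comp_iff f Set.univ x

end Manifold

/-! ### Models -/

/-- The exact set of free points need not be known: any set between a connected dense set `D` and
its closure is again connected and dense. -/
theorem isComplexModel_top {n : ℕ} {G : Type} [Group G] [MulAction G (⊤ : Opens (Fin n → ℂ))]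
    [Countable G]
    (hol : ∀ g : G, ∃ f : (Fin n → ℂ) → Fin n → ℂ, Differentiable ℂ f ∧
      ∀ z : (⊤ : Opens (Fin n → ℂ)), ((g • z : (⊤ : Opens (Fin n → ℂ))) : Fin n → ℂ) = f z)
    {D : Set (Fin n → ℂ)} (hD : IsConnected D) (hD' : Dense D)
    (free : ∀ z : (⊤ : Opens (Fin n → ℂ)), (z : Fin n → ℂ) ∈ D → ∀ g : G, g • z = z → g = 1) :
    IsComplexModel n (⊤ : Opens (Fin n → ℂ)) G := by
  let e : (⊤ : Opens (Fin n → ℂ)) ≃ₜ (Fin n → ℂ) := Homeomorph.Set.univ _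
  have hsub : e ⁻¹' D ⊆ {v | MulAction.stabilizer G v = ⊥} := fun z hz =>
    (Subgroup.eq_bot_iff_forall _).2 fun g hg => free z hz g hg
  have hdense : Dense (e ⁻¹' D) := hD'.preimage e.isOpenMap
  refine
    { isManifold := inferInstance
      t2 := inferInstance
      secondCountable := inferInstance
      simplyConnected := ?_
      discrete := inferInstance
      holomorphic := fun g => ?_
      connected_free := ?_
      dense_free := hdense.mono hsub }
  · have : ContractibleSpace (⊤ : Opens (Fin n → ℂ)) := e.contractibleSpace
    infer_instance
  · obtain ⟨f, hf, hgf⟩ := hol g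
    refine mdifferentiable_subtypeVal_comp_iff.1 ?_
    simp only [hgf]
    exact hf.mdifferentiable.comp mdifferentiable_subtypeVal
  · refine IsConnected.subset_closure (s := e ⁻¹' D) ?_ hsub (by rw [hdense.closure_eq]; simp)
    rwa [e.isConnected_preimage]

/-! ### Models on universal covers -/

section LiftGroup

variable {k : ℕ} {V : Type} [TopologicalSpace V] [ChartedSpace (Fin k → ℂ) V]
  {G : Type} [Group G] [MulAction G V] {U : Opens V} {A : UniversalCover k U}

theorem UniversalCover.lift_unique {f f' : A.total → A.total} (hf : Continuous f)
    (hf' : Continuous f') (h : ∀ u, (A.proj (f u) : V) = A.proj (f' u)) {u₀ : A.total}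
    (h₀ : f u₀ = f' u₀) : f = f' := by
  have := A.simplyConnected
  exact A.isCovering.eq_of_comp_eq hf hf' (funext fun u => Subtype.ext (h u)) u₀ h₀

/-- A discrete subspace of a second countable space is countable; over points outside `U` the fibre
is empty. -/
theorem UniversalCover.countable_fiber [SecondCountableTopology A.total] (v : V) :
    Countable {u : A.total // (A.proj u : V) = v} := by
  by_cases hv : ∃ u, (A.proj u : V) = v
  · obtain ⟨u, rfl⟩ := hv
    have : DiscreteTopology (A.proj ⁻¹' {A.proj u}) := (A.isCovering _).1
    have : Countable (A.proj ⁻¹' {A.proj u}) := countable_of_Lindelof_of_discrete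
    exact Function.Injective.countable
      (f := fun w : {w : A.total // (A.proj w : V) = A.proj u} =>
        (⟨w.1, Subtype.ext w.2⟩ : A.proj ⁻¹' {A.proj u}))
      fun a b h => Subtype.ext (congrArg (fun x : A.proj ⁻¹' {A.proj u} => x.1) h)
  · have : IsEmpty {u : A.total // (A.proj u : V) = v} := ⟨fun u => hv ⟨u.1, u.2⟩⟩
    infer_instance

/-- A lift is determined by an element of `G` that it covers and by the image of one base point,
which lies in a countable fibre. -/
theorem countable_liftGroup [Countable G] [SecondCountableTopology A.total] :
    Countable (liftGroup G U A) := by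
  have := A.simplyConnected
  obtain ⟨u₀⟩ : Nonempty A.total := inferInstance
  have := fun v : V => A.countable_fiber v
  choose γ hγ using fun f : liftGroup G U A => f.2.2.2
  refine Function.Injective.countable (β := Σ g : G, {u : A.total // (A.proj u : V) = g • (A.proj u₀ : V)})
    (f := fun f => ⟨γ f, ⟨f.1 u₀, hγ f u₀⟩⟩) fun f f' h => ?_
  rw [Sigma.mk.injEq] at h
  obtain ⟨h1, h2⟩ := h
  have h3 : f.1 u₀ = f'.1 u₀ := by
    generalize_proofs p q at h2
    revert p q
    rw [h1]
    intro p q h2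
    exact congrArg Subtype.val (eq_of_heq h2)
  refine Subtype.ext (Equiv.coe_fn_injective (A.lift_unique f.2.1.continuous f'.2.1.continuous
    (fun u => ?_) h3))
  rw [hγ, hγ, h1]

/-- The group of lifts to a universal cover is a model as soon as the cover contains a connected
dense set over the points with trivial stabilizer. -/
theorem isComplexModel_liftGroup (hV : IsComplexModel k V G) [T2Space A.total]
    [SecondCountableTopology A.total] {D : Set A.total} (hD : IsConnected D) (hD' : Dense D)
    (free : ∀ u ∈ D, MulAction.stabilizer G (A.proj u : V) = ⊥) :
    IsComplexModel k A.total (liftGroup G U A) := by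
  have := hV.discrete
  have hsub : D ⊆ {u | MulAction.stabilizer (liftGroup G U A) u = ⊥} := by
    refine fun u hu => (Subgroup.eq_bot_iff_forall _).2 fun f hf => ?_
    have hfu : f.1 u = u := hf
    obtain ⟨g, hg⟩ := f.2.2.2
    -- A lift that fixes a point over a free point covers the identity; as a deck transformation
    -- with a fixed point it is trivial.
    have h1 : g ∈ MulAction.stabilizer G (A.proj u : V) := by
      rw [MulAction.mem_stabilizer_iff, ← hg, hfu]
    rw [free u hu, Subgroup.mem_bot] at h1
    refine Subtype.ext (Equiv.coe_fn_injective (A.lift_unique f.2.1.continuous continuous_id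
      (fun w => ?_) hfu))
    rw [hg, h1, one_smul]
    rfl
  exact
    { isManifold := A.isManifold
      t2 := inferInstance
      secondCountable := inferInstance
      simplyConnected := A.simplyConnected
      discrete := countable_liftGroup
      holomorphic := fun f => f.2.1
      connected_free := hD.subset_closure hsub (by rw [hD'.closure_eq]; simp)
      dense_free := hD'.mono hsub }

end LiftGroup

/-! ### Charts and maximal atlases -/

namespace Chart

variable {k : ℕ} {M : Type*} [TopologicalSpace M]

theorem Compatible.symm {c c' : Chart k M} (h : c.Compatible c') : c'.Compatible c := by
  intro hne
  obtain ⟨A, B, hA, hB, g, hg, hg', e⟩ := h (by rwa [Set.inter_comm])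
  exact ⟨B, A, hB, hA, g.symm, hg', hg, fun u => by rw [← e, g.apply_symm_apply]⟩

theorem toSpace_mem (c : Chart k M) (v : c.domain) : c.toSpace v ∈ c.target :=
  (c.φ _).2

theorem exists_toSpace_eq (c : Chart k M) {m : M} (hm : m ∈ c.target) : ∃ v, c.toSpace v = m := by
  obtain ⟨q, hq⟩ := c.φ.surjective ⟨m, hm⟩
  obtain ⟨v, rfl⟩ := Quotient.exists_rep q
  exact ⟨v, congrArg Subtype.val hq⟩

theorem isOpenMap_toSpace (c : Chart k M) : IsOpenMap c.toSpace := by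
  have : ContinuousConstSMul c.Γ c.domain := ⟨fun g => (c.isModel.holomorphic g).continuous⟩
  exact c.target.isOpen.isOpenMap_subtype_val.comp
    (c.φ.isOpenMap.comp (isOpenMap_quotient_mk'_mul (Γ := c.Γ) (T := c.domain)))

/-- The universal cover of the domain of a chart, seen as the overlap of the chart with itself. -/
def selfCover (c : Chart k M) : UniversalCover k (c.overlap c) :=
  let e : c.domain ≃ₜ c.overlap c :=
    { toFun := fun v => ⟨v, c.toSpace_mem v⟩
      invFun := Subtype.val
      left_inv := fun _ => rfl
      right_inv := fun _ => rfl
      continuous_toFun := by fun_prop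
      continuous_invFun := by fun_prop }
  { total := c.domain
    isManifold := c.isModel.isManifold
    simplyConnected := c.isModel.simplyConnected
    proj := e
    isCovering := IsCoveringMap.homeomorph_comp (f := id) (fun x => IsEvenlyCovered.to_isEvenlyCovered_preimage
      (I := Unit) ⟨inferInstance, Set.univ, trivial, isOpen_univ, isOpen_univ,
        (Homeomorph.prodPUnit _).symm, fun _ => rfl⟩) e
    surjective := e.surjective
    holomorphic := mdifferentiable_subtypeVal_comp_iff.1 mdifferentiable_id }

/-- The domain is simply connected, hence its own universal cover. Self-compatibility is needed to
adjoin a chart to a maximal family. -/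
theorem compatible_refl (c : Chart k M) : c.Compatible c := by
  intro _
  have : T2Space c.selfCover.total := c.isModel.t2
  have : SecondCountableTopology c.selfCover.total := c.isModel.secondCountable
  have h : IsComplexModel k c.selfCover.total (liftGroup c.Γ (c.overlap c) c.selfCover) :=
    isComplexModel_liftGroup c.isModel c.isModel.connected_free c.isModel.dense_free fun _ hu => hu
  exact ⟨c.selfCover, c.selfCover, h, h, Equiv.refl _, mdifferentiable_id, mdifferentiable_id,
    fun _ => rfl⟩

end Chart

/-- Every covering set of pairwise compatible charts is contained in a maximal atlas. -/
theorem exists_complexQuasifold {k : ℕ} {M : Type*} [TopologicalSpace M] (S : Set (Chart k M))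
    (hcover : ∀ m, ∃ c ∈ S, m ∈ c.target) (hS : ∀ c ∈ S, ∀ c' ∈ S, c.Compatible c') :
    ∃ 𝒜 : ComplexQuasifold k M, S ⊆ 𝒜.atlas := by
  -- Zorn's lemma avoids any appeal to transitivity of compatibility.
  obtain ⟨T, hST, hT⟩ := zorn_subset_nonempty
    {T : Set (Chart k M) | ∀ c ∈ T, ∀ c' ∈ T, c.Compatible c'} (fun C hC hchain _ => by
      refine ⟨⋃₀ C, ?_, fun s hs => Set.subset_sUnion_of_mem hs⟩
      rintro c ⟨s, hs, hc⟩ c' ⟨s', hs', hc'⟩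
      rcases hchain.total hs hs' with h | h
      · exact hC hs' c (h hc) c' hc'
      · exact hC hs c hc c' (h hc')) S hS
  refine ⟨⟨T, fun m => ?_, hT.prop, fun c hc => ?_⟩, hST⟩
  · obtain ⟨c, hc, hm⟩ := hcover m
    exact ⟨c, hST hc, hm⟩
  · refine hT.le_of_ge (y := insert c T) ?_ (Set.subset_insert c T) (Set.mem_insert c T)
    rintro a (ha | ha) b (hb | hb)
    · rw [ha, hb]
      exact c.compatible_refl
    · exact ha ▸ hc b hb
    · exact hb ▸ (hc a ha).symm
    · exact hT.prop a ha b hb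

/-- A map that has holomorphic lifts around every point is holomorphic, continuity being
automatic. -/
theorem isHolomorphicOnProd_of_lifts {k l r : ℕ} {D M N : Type*} [TopologicalSpace D]
    [TopologicalSpace M] [TopologicalSpace N] {𝒟 : ComplexQuasifold k D} {𝒜 : ComplexQuasifold l M}
    {ℬ : ComplexQuasifold r N} {f : D × M → N}
    (h : ∀ (a : D) (m : M), ∃ c ∈ 𝒟.atlas, ∃ c' ∈ 𝒜.atlas, ∃ e ∈ ℬ.atlas,
      a ∈ c.target ∧ m ∈ c'.target ∧ f (a, m) ∈ e.target ∧
      ∃ F : c.domain × c'.domain → e.domain,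
        MDifferentiable (𝓘(ℂ, Fin k → ℂ).prod 𝓘(ℂ, Fin l → ℂ)) 𝓘(ℂ, Fin r → ℂ) F ∧
        ∀ v w, e.toSpace (F (v, w)) = f (c.toSpace v, c'.toSpace w)) :
    IsHolomorphicOnProd 𝒟 𝒜 ℬ f := by
  refine ⟨continuous_iff_continuousAt.2 fun ⟨a, m⟩ => ?_, h⟩
  obtain ⟨c, -, c', -, e, -, ha, hm, -, F, hF, hFf⟩ := h a m
  obtain ⟨v, rfl⟩ := c.exists_toSpace_eq ha
  obtain ⟨w, rfl⟩ := c'.exists_toSpace_eq hm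
  -- Since the product of the two chart projections is open, continuity of the lift at `(v, w)`
  -- descends to `f`.
  have h1 : IsOpenMap (Prod.map c.toSpace c'.toSpace) :=
    c.isOpenMap_toSpace.prodMap c'.isOpenMap_toSpace
  have h2 : ContinuousAt (f ∘ Prod.map c.toSpace c'.toSpace) (v, w) := by
    have : f ∘ Prod.map c.toSpace c'.toSpace = e.toSpace ∘ F := funext fun p => (hFf p.1 p.2).symm
    rw [this]
    exact (e.continuous_toSpace.comp hF.continuous).continuousAt
  exact (Filter.tendsto_map'_iff.2 h2).mono_left (h1.nhds_le (v, w))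

/-! ### Charts from open maps -/

/-- The chart given by an open map from the total space of a model whose fibres are the orbits. -/
def Chart.ofOpenMap {k : ℕ} {M : Type*} [TopologicalSpace M] {U : Opens (Fin k → ℂ)} {G : Type}
    [Group G] [MulAction G U] (hU : IsComplexModel k U G) (p : U → M) (hp : Continuous p)
    (hp' : IsOpenMap p) (h : ∀ v w, p v = p w ↔ v ∈ MulAction.orbit G w) : Chart k M where
  domain := U
  Γ := G
  isModel := hU
  target := ⟨Set.range p, hp'.isOpen_range⟩
  φ :=
    let q : MulAction.orbitRel.Quotient G U → M := Quotient.lift p fun v w hvw => (h v w).2 hvw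
    have hq : Topology.IsOpenEmbedding q := by
      refine .of_continuous_injective_isOpenMap (hp.quotient_lift _) ?_ ?_
      · rintro ⟨v⟩ ⟨w⟩ hvw
        exact Quotient.sound ((h v w).1 hvw)
      · intro s hs
        have : q '' s = p '' (Quotient.mk _ ⁻¹' s) := by
          rw [← Set.image_preimage_eq s Quotient.mk_surjective, Set.image_image,
            Set.image_preimage_eq s Quotient.mk_surjective]
          rfl
        rw [this]
        exact hp' _ (hs.preimage continuous_quotient_mk')
    hq.isEmbedding.toHomeomorph.trans (Homeomorph.setCongr (by
      refine Set.Subset.antisymm ?_ ?_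
      · rintro _ ⟨⟨v⟩, rfl⟩
        exact ⟨v, rfl⟩
      · rintro _ ⟨v, rfl⟩
        exact ⟨Quotient.mk _ v, rfl⟩))

/-! ### The complex torus -/

section Torus

variable {E : Type*} [AddCommGroup E] [Module ℝ E] {n d : ℕ} {Δ : Set (Module.Dual ℝ E)}
  {X : Fin d → E} {lam : Fin d → ℝ} {Q : AddSubgroup E} (hX : ∀ j, X j ∈ Q)

/-- The function `w ↦ exp (2πi w)`. -/
def expTwoPiI (w : ℂ) : ℂ := Complex.exp (2 * Real.pi * Complex.I * w)

theorem expTwoPiI_ne_zero (w : ℂ) : expTwoPiI w ≠ 0 := Complex.exp_ne_zero _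

theorem expTwoPiI_zero : expTwoPiI 0 = 1 := by simp [expTwoPiI]

theorem expTwoPiI_add (v w : ℂ) : expTwoPiI (v + w) = expTwoPiI v * expTwoPiI w := by
  simp [expTwoPiI, mul_add, Complex.exp_add]

theorem expTwoPiI_neg_mul_self (w : ℂ) : expTwoPiI (-w) * expTwoPiI w = 1 := by
  rw [← expTwoPiI_add, neg_add_cancel, expTwoPiI_zero]

theorem differentiable_expTwoPiI : Differentiable ℂ expTwoPiI := by
  unfold expTwoPiI
  fun_prop

theorem expTwoPiI_eq_iff {v w : ℂ} : expTwoPiI v = expTwoPiI w ↔ ∃ m : ℤ, v = w + m := by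
  rw [expTwoPiI, expTwoPiI, Complex.exp_eq_exp_iff_exists_int]
  refine exists_congr fun m => ⟨fun h => ?_, fun h => ?_⟩
  · have h2 : (2 * Real.pi * Complex.I : ℂ) ≠ 0 := Complex.two_pi_I_ne_zero
    apply mul_left_cancel₀ h2
    rw [h]
    ring
  · rw [h]
    ring

theorem expTwoPiI_eq_one_iff {w : ℂ} : expTwoPiI w = 1 ↔ ∃ m : ℤ, w = m := by
  rw [← expTwoPiI_zero, expTwoPiI_eq_iff]
  simp

theorem expTwoPiI_neg_log_div {y : ℂ} (hy : y ≠ 0) :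
    expTwoPiI (-(Complex.log y / (2 * Real.pi * Complex.I))) * y = 1 := by
  have h2 : (2 * Real.pi * Complex.I : ℂ) ≠ 0 := Complex.two_pi_I_ne_zero
  rw [expTwoPiI, mul_neg, mul_div_cancel₀ _ h2, Complex.exp_neg, Complex.exp_log hy,
    inv_mul_cancel₀ hy]

theorem exists_expTwoPiI_eq {y : ℂ} (hy : y ≠ 0) : ∃ w, expTwoPiI w = y := by
  have h2 : (2 * Real.pi * Complex.I : ℂ) ≠ 0 := Complex.two_pi_I_ne_zero
  exact ⟨Complex.log y / (2 * Real.pi * Complex.I), by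
    rw [expTwoPiI, mul_div_cancel₀ _ h2, Complex.exp_log hy]⟩

theorem torus_mk_vadd_apply (Y : Fin d → ℂ) (z : Fin d → ℂ) (j : Fin d) :
    ((QuotientAddGroup.mk Y : Torus d) +ᵥ z) j = expTwoPiI (Y j) * z j := rfl

theorem torus_mk_eq_iff {Y Z : Fin d → ℂ} :
    (QuotientAddGroup.mk Y : Torus d) = QuotientAddGroup.mk Z ↔
      ∀ j, expTwoPiI (Y j) = expTwoPiI (Z j) := by
  constructor
  · intro h j
    have := congrFun (congrArg (fun t : Torus d => t +ᵥ (1 : Fin d → ℂ)) h) j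
    simpa [torus_mk_vadd_apply] using this
  · intro h
    choose m hm using fun j => expTwoPiI_eq_iff.1 (h j).symm
    rw [QuotientAddGroup.eq]
    refine ⟨m, funext fun j => ?_⟩
    simp [hm]

theorem torusProj_mk (Y : Fin d → ℂ) :
    torusProj X Q hX (QuotientAddGroup.mk Y) = Quasitorus.mk Q (complexProj X Y) := rfl

theorem quasitorus_mk_eq_zero_iff {v : ℂ ⊗[ℝ] E} :
    Quasitorus.mk Q v = 0 ↔ ∃ q ∈ Q, (1 : ℂ) ⊗ₜ[ℝ] q = v :=
  QuotientAddGroup.eq_zero_iff v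

theorem mk_mem_kernelGroup_iff {Y : Fin d → ℂ} :
    (QuotientAddGroup.mk Y : Torus d) ∈ kernelGroup X Q hX ↔
      ∃ q ∈ Q, (1 : ℂ) ⊗ₜ[ℝ] q = complexProj X Y :=
  quasitorus_mk_eq_zero_iff

theorem slice_apply {r : Fin n → Fin d} (hr : Function.Injective r) (z : Fin n → ℂ) (i : Fin n) :
    slice r z (r i) = z i :=
  hr.extend_apply _ _ _

theorem slice_apply_of_notMem {r : Fin n → Fin d} (z : Fin n → ℂ) {j : Fin d}
    (hj : j ∉ Set.range r) : slice r z j = 1 :=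
  Function.extend_apply' _ _ _ hj

/-- The base point has coordinates 0 on the range of `r`, which impose nothing, and 1 elsewhere. -/
theorem mem_stabilizer_slice_zero {r : Fin n → Fin d} (hr : Function.Injective r) {t : Torus d} :
    t ∈ AddAction.stabilizer (Torus d) (slice r (0 : Fin n → ℂ)) ↔
      ∀ j ∉ Set.range r, (Additive.toMul (torusExp d t) j : ℂ) = 1 := by
  rw [AddAction.mem_stabilizer_iff, funext_iff]
  refine forall_congr' fun j => ?_
  rw [torus_vadd_apply]
  by_cases hj : j ∈ Set.range r
  · obtain ⟨i, rfl⟩ := hj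
    simp [slice_apply hr]
  · simp [slice_apply_of_notMem _ hj, hj]

theorem toricSpace_mk_eq_iff {z z' : faceOrbits Δ X lam} :
    ToricSpace.mk hX z = ToricSpace.mk hX z' ↔
      ∃ t ∈ kernelGroup X Q hX, t +ᵥ (z' : Fin d → ℂ) = z := by
  rw [ToricSpace.mk, ToricSpace.mk, Quotient.eq, AddAction.orbitRel_apply,
    AddAction.mem_orbit_iff]
  constructor
  · rintro ⟨t, rfl⟩
    exact ⟨t, t.2, rfl⟩
  · rintro ⟨t, ht, h⟩
    exact ⟨⟨t, ht⟩, Subtype.ext h⟩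

theorem continuous_toricSpace_mk :
    Continuous (ToricSpace.mk hX : faceOrbits Δ X lam → ToricSpace Δ X lam Q hX) :=
  continuous_quotient_mk'

theorem toricSpace_mk_surjective :
    Function.Surjective (ToricSpace.mk hX : faceOrbits Δ X lam → ToricSpace Δ X lam Q hX) :=
  Quotient.mk_surjective

/-! ### Vertices and the associated charts -/

variable (Δ X lam n) in
/-- A vertex of a polytope together with an enumeration of the facets through it whose normals form
a basis. -/
structure VertexFrame where
  vertex : Module.Dual ℝ E
  isVertex : IsVertex Δ vertex
  eq_iInter : Δ = ⋂ j, {μ | lam j ≤ μ (X j)}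
  facets : Fin n → Fin d
  range_facets : Set.range facets = activeSet X lam vertex
  basis : Module.Basis (Fin n) ℝ E
  basis_apply : ∀ i, basis i = X (facets i)

/-- The coordinates of the complexification of a vector space with respect to a real basis. -/
def complexCoords (B : Module.Basis (Fin n) ℝ E) : (ℂ ⊗[ℝ] E) ≃ₗ[ℂ] Fin n → ℂ :=
  (B.baseChange ℂ).equivFun

theorem complexCoords_tmul (B : Module.Basis (Fin n) ℝ E) (i k : Fin n) :
    complexCoords B ((1 : ℂ) ⊗ₜ[ℝ] B i) k = if i = k then 1 else 0 := by
  rw [complexCoords, ← Module.Basis.baseChange_apply, Module.Basis.equivFun_self]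

theorem sum_complexCoords (B : Module.Basis (Fin n) ℝ E) (v : ℂ ⊗[ℝ] E) :
    ∑ i, complexCoords B v i • (1 : ℂ) ⊗ₜ[ℝ] B i = v := by
  conv_rhs => rw [← (B.baseChange ℂ).sum_equivFun v]
  simp only [Module.Basis.baseChange_apply]
  rfl

theorem complexProj_apply (Y : Fin d → ℂ) :
    complexProj X Y = ∑ j, Y j • (1 : ℂ) ⊗ₜ[ℝ] X j :=
  Fintype.linearCombination_apply ..

namespace VertexFrame

variable (f : VertexFrame n Δ X lam)

theorem facets_injective : Function.Injective f.facets := fun a b h =>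
  f.basis.injective (by rw [f.basis_apply, f.basis_apply, h])

/-- Only coordinates at facets through the vertex can vanish, and by simplicity every subset of
these facets is the exact set of facets containing some face. -/
theorem slice_mem (z : Fin n → ℂ) : slice f.facets z ∈ faceOrbits Δ X lam := by
  have hJ : {j | slice f.facets z j = 0} ⊆ Set.range f.facets := by
    intro j hj
    by_contra hjr
    exact one_ne_zero ((slice_apply_of_notMem z hjr).symm.trans hj)
  exact exists_isFace_iff_mem f.eq_iInter f.isVertex.mem f.range_facets f.basis f.basis_apply hJ

/-- The vector of `ℂ^d` supported on the facets at the vertex that lies over `v`. -/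
def lift (v : ℂ ⊗[ℝ] E) : Fin d → ℂ :=
  Function.extend f.facets (complexCoords f.basis v) 0

theorem lift_apply (v : ℂ ⊗[ℝ] E) (i : Fin n) :
    f.lift v (f.facets i) = complexCoords f.basis v i :=
  f.facets_injective.extend_apply _ _ _

theorem lift_apply_of_notMem (v : ℂ ⊗[ℝ] E) {j : Fin d} (hj : j ∉ Set.range f.facets) :
    f.lift v j = 0 :=
  Function.extend_apply' _ _ _ hj

/-- The normals at the vertex are a basis of the complexification, so `lift` is a section of π_ℂ. -/
theorem complexProj_lift (v : ℂ ⊗[ℝ] E) : complexProj X (f.lift v) = v := by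
  conv_rhs => rw [← sum_complexCoords f.basis v]
  rw [complexProj_apply]
  refine (Fintype.sum_of_injective f.facets f.facets_injective _ _ (fun j hj => ?_)
    fun i => ?_).symm
  · rw [f.lift_apply_of_notMem v hj, zero_smul]
  · rw [f.lift_apply, f.basis_apply]

/-- The coordinate map of the chart at a vertex. -/
def toToric (z : Fin n → ℂ) : ToricSpace Δ X lam Q hX :=
  ToricSpace.mk hX ⟨slice f.facets z, f.slice_mem z⟩

/-! ### Moving points into the slice -/

theorem continuous_slice (r : Fin n → Fin d) : Continuous (slice r : (Fin n → ℂ) → Fin d → ℂ) := by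
  refine continuous_pi fun j => ?_
  by_cases hj : ∃ i, r i = j
  · simp only [slice, Function.extend_def, hj, dif_pos]
    fun_prop
  · simp only [slice, Function.extend_def, hj, dif_neg, not_false_eq_true]
    exact continuous_const

theorem continuous_toToric : Continuous (f.toToric hX) :=
  (continuous_toricSpace_mk hX).comp ((continuous_slice f.facets).subtype_mk _)

open Classical in
/-- An element of the Lie algebra of `N_ℂ` which moves `y` to the slice. -/
def normalizer (y : Fin d → ℂ) : Fin d → ℂ :=
  -- `L` turns the coordinates away from the facets into 1. Subtracting the lift puts the result in
  -- the kernel of π_ℂ without changing those coordinates.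
  let L : Fin d → ℂ := fun j => if j ∈ Set.range f.facets then 0 else
    -(Complex.log (y j) / (2 * Real.pi * Complex.I))
  L - f.lift (complexProj X L)

/-- The point of the slice to which `y` is moved by `normalizer`. -/
def normalForm (y : Fin d → ℂ) (i : Fin n) : ℂ :=
  expTwoPiI (f.normalizer y (f.facets i)) * y (f.facets i)

theorem normalizer_mem (y : Fin d → ℂ) :
    (QuotientAddGroup.mk (f.normalizer y) : Torus d) ∈ kernelGroup X Q hX := by
  rw [mk_mem_kernelGroup_iff]
  exact ⟨0, Q.zero_mem, by simp [normalizer, complexProj_lift]⟩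

theorem normalizer_vadd {y : Fin d → ℂ} (hy : ∀ j ∉ Set.range f.facets, y j ≠ 0) :
    (QuotientAddGroup.mk (f.normalizer y) : Torus d) +ᵥ y = slice f.facets (f.normalForm y) := by
  funext j
  rw [torus_mk_vadd_apply]
  by_cases hj : j ∈ Set.range f.facets
  · obtain ⟨i, rfl⟩ := hj
    rw [slice_apply f.facets_injective, normalForm]
  · rw [slice_apply_of_notMem _ hj]
    simp only [normalizer, hj, if_false, Pi.sub_apply, f.lift_apply_of_notMem _ hj, sub_zero]
    exact expTwoPiI_neg_log_div (hy j hj)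

/-- The preliminary translation by `t` allows `normalForm` to be applied close to the slice, where
its logarithms are continuous. -/
theorem toToric_normalForm {x : faceOrbits Δ X lam} {t : Torus d} (ht : t ∈ kernelGroup X Q hX)
    (hx : ∀ j ∉ Set.range f.facets, (t +ᵥ (x : Fin d → ℂ)) j ≠ 0) :
    f.toToric hX (f.normalForm (t +ᵥ (x : Fin d → ℂ))) = ToricSpace.mk hX x := by
  rw [toToric, toricSpace_mk_eq_iff]
  exact ⟨_, add_mem (f.normalizer_mem hX _) ht, by rw [add_vadd, f.normalizer_vadd hx]⟩

theorem normalForm_slice (u : Fin n → ℂ) : f.normalForm (slice f.facets u) = u := by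
  have h : f.normalizer (slice f.facets u) = 0 := by
    have hL : (fun j => if j ∈ Set.range f.facets then 0 else
        -(Complex.log (slice f.facets u j) / (2 * Real.pi * Complex.I))) = (0 : Fin d → ℂ) := by
      funext j
      by_cases hj : j ∈ Set.range f.facets
      · simp only [hj, if_true, Pi.zero_apply]
      · simp only [hj, if_false, slice_apply_of_notMem _ hj, Complex.log_one, zero_div, neg_zero,
          Pi.zero_apply]
    funext j
    simp only [normalizer]
    rw [hL]
    by_cases hj : j ∈ Set.range f.facets
    · obtain ⟨i, rfl⟩ := hj
      simp [f.lift_apply]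
    · simp [f.lift_apply_of_notMem _ hj]
  funext i
  rw [normalForm, h, slice_apply f.facets_injective]
  simp [expTwoPiI_zero]

/-- On the slice the logarithms are taken at 1, inside the slit plane; the rest is linear algebra
and exponentials. -/
theorem continuousAt_normalForm (u : Fin n → ℂ) :
    ContinuousAt f.normalForm (slice f.facets u) := by
  have hL : ContinuousAt (fun y : Fin d → ℂ => fun j => if j ∈ Set.range f.facets then (0 : ℂ) else
      -(Complex.log (y j) / (2 * Real.pi * Complex.I))) (slice f.facets u) := by
    refine continuousAt_pi.2 fun j => ?_
    by_cases hj : j ∈ Set.range f.facets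
    · simp only [hj, if_true]
      exact continuousAt_const
    · simp only [hj, if_false]
      refine ((ContinuousAt.clog (continuous_apply j).continuousAt ?_).div_const _).neg
      rw [slice_apply_of_notMem _ hj]
      exact Complex.one_mem_slitPlane
  refine continuousAt_pi.2 fun i => ?_
  have hlin : Continuous fun L : Fin d → ℂ => L (f.facets i) -
      complexCoords f.basis (complexProj X L) i := by
    refine (continuous_apply _).sub ((continuous_apply i).comp ?_)
    exact ((complexCoords f.basis).toLinearMap ∘ₗ complexProj X).continuous_of_finiteDimensional
  have : f.normalForm = fun y i => expTwoPiI ((fun L : Fin d → ℂ => L (f.facets i) -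
      complexCoords f.basis (complexProj X L) i) (fun j => if j ∈ Set.range f.facets then (0 : ℂ)
        else -(Complex.log (y j) / (2 * Real.pi * Complex.I)))) * y (f.facets i) := by
    funext y i
    simp only [normalForm, normalizer, Pi.sub_apply, f.lift_apply]
  simp only [this]
  exact ((differentiable_expTwoPiI.continuous.comp hlin).continuousAt.comp hL).mul
    (continuous_apply _).continuousAt

theorem toToric_eq_mk_iff {u : Fin n → ℂ} {x : faceOrbits Δ X lam} :
    f.toToric hX u = ToricSpace.mk hX x ↔
      ∃ t ∈ kernelGroup X Q hX, t +ᵥ (x : Fin d → ℂ) = slice f.facets u :=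
  toricSpace_mk_eq_iff hX

/-- If `x` is equivalent to a slice point of `U`, translate it there by some `t` in N_ℂ. Points `y`
near `x` are then carried into `U` by `normalForm` after the same translation, because `normalForm`
retracts continuously onto the slice. -/
theorem isOpenMap_toToric : IsOpenMap (f.toToric hX) := by
  intro U hU
  have hq : Topology.IsQuotientMap
      (ToricSpace.mk hX : faceOrbits Δ X lam → ToricSpace Δ X lam Q hX) := isQuotientMap_quotient_mk'
  rw [← hq.isOpen_preimage, isOpen_iff_mem_nhds]
  rintro x ⟨u, hu, hux⟩
  obtain ⟨t, ht, htx⟩ := (f.toToric_eq_mk_iff hX).1 hux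
  have hc : Continuous fun y : faceOrbits Δ X lam => t +ᵥ (y : Fin d → ℂ) := by
    refine continuous_pi fun j => ?_
    simp only [torus_vadd_apply]
    exact continuous_const.mul ((continuous_apply j).comp continuous_subtype_val)
  have h1 : ContinuousAt (fun y : faceOrbits Δ X lam => f.normalForm (t +ᵥ (y : Fin d → ℂ))) x := by
    refine ContinuousAt.comp (g := f.normalForm) ?_ hc.continuousAt
    rw [htx]
    exact f.continuousAt_normalForm u
  have h2 : ∀ᶠ y : faceOrbits Δ X lam in nhds x, f.normalForm (t +ᵥ (y : Fin d → ℂ)) ∈ U := by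
    refine h1.eventually (hU.mem_nhds ?_)
    change f.normalForm (t +ᵥ (x : Fin d → ℂ)) ∈ U
    rwa [htx, f.normalForm_slice]
  have h3 : ∀ᶠ y : faceOrbits Δ X lam in nhds x, ∀ j, j ∉ Set.range f.facets →
      (t +ᵥ (y : Fin d → ℂ)) j ≠ 0 := by
    refine Filter.eventually_all.2 fun j => ?_
    by_cases hj : j ∈ Set.range f.facets
    · exact Filter.Eventually.of_forall fun _ h => absurd hj h
    · have := ((continuous_apply j).comp hc).continuousAt (x := x)
      refine (this.eventually_ne (y := 0) ?_).mono fun _ h _ => h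
      simp only [Function.comp_apply]
      rw [htx, slice_apply_of_notMem _ hj]
      exact one_ne_zero
  filter_upwards [h2, h3] with y hy2 hy3
  exact ⟨_, hy2, f.toToric_normalForm hX ht hy3⟩

theorem range_toToric : Set.range (f.toToric hX) =
    {m | ∃ z : faceOrbits Δ X lam, (∀ j, j ∉ Set.range f.facets → (z : Fin d → ℂ) j ≠ 0) ∧
      m = ToricSpace.mk hX z} := by
  ext m
  constructor
  · rintro ⟨u, rfl⟩
    exact ⟨_, fun j hj => by simp [slice_apply_of_notMem _ hj], rfl⟩
  · rintro ⟨z, hz, rfl⟩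
    refine ⟨_, f.toToric_normalForm hX (zero_mem _) ?_⟩
    simpa using hz

theorem mk_mem_range_toToric_iff {x : faceOrbits Δ X lam} :
    ToricSpace.mk hX x ∈ Set.range (f.toToric hX) ↔
      ∀ j ∉ Set.range f.facets, (x : Fin d → ℂ) j ≠ 0 := by
  rw [range_toToric]
  refine ⟨?_, fun h => ⟨x, h, rfl⟩⟩
  rintro ⟨z, hz, h⟩ j hj
  obtain ⟨t, -, ht⟩ := (toricSpace_mk_eq_iff hX).1 h
  rw [← ht, torus_vadd_apply]
  exact mul_ne_zero (Units.ne_zero _) (hz j hj)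

/-! ### The group at a vertex and its model -/

instance vertexAction (r : Fin n → Fin d) :
    MulAction (Multiplicative (vertexGroup X Q hX r)) (⊤ : Opens (Fin n → ℂ)) where
  smul g z := ⟨fun i => (Additive.toMul (torusExp d (g.toAdd : Torus d)) (r i) : ℂ) *
    (z : Fin n → ℂ) i, trivial⟩
  one_smul z := by
    refine Subtype.ext (funext fun i => ?_)
    change (Additive.toMul (torusExp d 0) (r i) : ℂ) * (z : Fin n → ℂ) i = (z : Fin n → ℂ) i
    simp
  mul_smul g h z := by
    refine Subtype.ext (funext fun i => ?_)
    change (Additive.toMul (torusExp d (g.toAdd + h.toAdd : Torus d)) (r i) : ℂ) *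
      (z : Fin n → ℂ) i = (Additive.toMul (torusExp d (g.toAdd : Torus d)) (r i) : ℂ) *
        ((Additive.toMul (torusExp d (h.toAdd : Torus d)) (r i) : ℂ) * (z : Fin n → ℂ) i)
    simp [mul_assoc]

theorem vertexAction_apply (r : Fin n → Fin d) (g : Multiplicative (vertexGroup X Q hX r))
    (z : (⊤ : Opens (Fin n → ℂ))) (i : Fin n) :
    ((g • z : (⊤ : Opens (Fin n → ℂ))) : Fin n → ℂ) i =
      (Additive.toMul (torusExp d (g.toAdd : Torus d)) (r i) : ℂ) * (z : Fin n → ℂ) i := rfl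

theorem slice_vertexAction {r : Fin n → Fin d} (hr : Function.Injective r)
    (g : Multiplicative (vertexGroup X Q hX r)) (z : (⊤ : Opens (Fin n → ℂ))) :
    slice r ((g • z : (⊤ : Opens (Fin n → ℂ))) : Fin n → ℂ) =
      (g.toAdd : Torus d) +ᵥ slice r (z : Fin n → ℂ) := by
  funext j
  rw [torus_vadd_apply]
  by_cases hj : j ∈ Set.range r
  · obtain ⟨i, rfl⟩ := hj
    rw [slice_apply hr, slice_apply hr, vertexAction_apply]
  · rw [slice_apply_of_notMem _ hj, slice_apply_of_notMem _ hj,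
      (mem_stabilizer_slice_zero hr).1 g.toAdd.2.1 j hj, mul_one]

/-- Together with the coordinates 1 of the slice, all `d` coordinates are nonzero, and the torus
acts freely on such points. -/
theorem eq_one_of_vertexAction {r : Fin n → Fin d} (hr : Function.Injective r)
    {g : Multiplicative (vertexGroup X Q hX r)} {z : (⊤ : Opens (Fin n → ℂ))}
    (hz : ∀ i, (z : Fin n → ℂ) i ≠ 0) (hg : g • z = z) : g = 1 := by
  have h : (g.toAdd : Torus d) = 0 := by
    obtain ⟨Y, hY⟩ := QuotientAddGroup.mk_surjective (g.toAdd : Torus d)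
    rw [← hY]
    refine torus_mk_eq_iff.2 fun j => ?_
    have hs := slice_vertexAction hX hr g z
    rw [hg, ← hY, funext_iff] at hs
    have := hs j
    rw [torus_mk_vadd_apply] at this
    have hne : slice r (z : Fin n → ℂ) j ≠ 0 := by
      by_cases hj : j ∈ Set.range r
      · obtain ⟨i, rfl⟩ := hj
        rw [slice_apply hr]
        exact hz i
      · rw [slice_apply_of_notMem _ hj]
        exact one_ne_zero
    rw [Pi.zero_apply, expTwoPiI_zero]
    exact mul_right_cancel₀ hne (by rw [← this, one_mul])
  exact Multiplicative.toAdd.injective (Subtype.ext h)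

/-- A representative `Y` has integer coordinates away from the facets and π_ℂ(Y) in `Q`. Removing
these integers changes neither the class nor membership of the projection in `Q`, and leaves a
vector supported on the facets, which is the lift of its projection. So elements of `Q` determine
the elements of the group. -/
theorem countable_vertexGroup [Countable Q] : Countable (vertexGroup X Q hX f.facets) := by
  classical
  have key : ∀ t : vertexGroup X Q hX f.facets, ∃ q : Q,
      (t : Torus d) = QuotientAddGroup.mk (f.lift ((1 : ℂ) ⊗ₜ[ℝ] (q : E))) := by
    rintro ⟨t, ht1, ht2⟩
    obtain ⟨Y, rfl⟩ := QuotientAddGroup.mk_surjective t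
    obtain ⟨q, hq, hqY⟩ := (mk_mem_kernelGroup_iff hX).1 ht2
    have h1 : ∀ j : Fin d, ∃ m : ℤ, j ∉ Set.range f.facets → Y j = m := by
      intro j
      by_cases hj : j ∈ Set.range f.facets
      · exact ⟨0, fun h => absurd hj h⟩
      · obtain ⟨m, hm⟩ := expTwoPiI_eq_one_iff.1
          ((mem_stabilizer_slice_zero f.facets_injective).1 ht1 j hj)
        exact ⟨m, fun _ => hm⟩
    choose m hm using h1
    -- At the facets themselves `m` is unconstrained, and nothing is to be subtracted there.
    let m' : Fin d → ℤ := fun j => if j ∈ Set.range f.facets then 0 else m j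
    have hm' : ∀ j ∉ Set.range f.facets, m' j = m j := fun j hj => if_neg hj
    refine ⟨⟨q - ∑ j, m' j • X j, sub_mem hq (sum_mem fun j _ => Q.zsmul_mem (hX j) _)⟩, ?_⟩
    have h2 : f.lift ((1 : ℂ) ⊗ₜ[ℝ] (q - ∑ j, m' j • X j)) = fun j => Y j - m' j := by
      have h3 : (1 : ℂ) ⊗ₜ[ℝ] (q - ∑ j, m' j • X j) =
          ∑ i, (Y (f.facets i)) • (1 : ℂ) ⊗ₜ[ℝ] f.basis i := by
        have h4 : ∀ j, (1 : ℂ) ⊗ₜ[ℝ] (m' j • X j) = (m' j : ℂ) • (1 : ℂ) ⊗ₜ[ℝ] X j := by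
          intro j
          rw [Int.cast_smul_eq_zsmul]
          exact map_zsmul (TensorProduct.mk ℝ ℂ E 1) (m' j) (X j)
        rw [TensorProduct.tmul_sub, hqY, TensorProduct.tmul_sum, complexProj_apply,
          ← Finset.sum_sub_distrib]
        simp only [h4, ← sub_smul]
        refine (Fintype.sum_of_injective f.facets f.facets_injective _ _ (fun j hj => ?_)
          fun i => ?_).symm
        · simp [hm' j hj, hm j hj]
        · simp [m', f.basis_apply]
      funext j
      by_cases hj : j ∈ Set.range f.facets
      · obtain ⟨i, rfl⟩ := hj
        rw [f.lift_apply, h3, map_sum]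
        simp [complexCoords_tmul, m']
      · rw [f.lift_apply_of_notMem _ hj]
        simp [hm' j hj, hm j hj]
    rw [h2]
    refine torus_mk_eq_iff.2 fun j => ?_
    exact expTwoPiI_eq_iff.2 ⟨m' j, by ring⟩
  choose q hq using key
  refine Function.Injective.countable (f := q) fun t t' h => ?_
  exact Subtype.ext (by rw [hq, hq, h])

/-- The points all of whose coordinates are nonzero. -/
def nonzeroPoints (n : ℕ) : Set (Fin n → ℂ) := {z | ∀ i, z i ≠ 0}

theorem nonzeroPoints_eq_pi : nonzeroPoints n = Set.univ.pi fun _ => ({0}ᶜ : Set ℂ) := by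
  ext z
  simp [nonzeroPoints]

theorem isConnected_nonzeroPoints : IsConnected (nonzeroPoints n) := by
  rw [nonzeroPoints_eq_pi, isConnected_univ_pi]
  exact fun _ => isConnected_compl_singleton_of_one_lt_rank (by simp) 0

theorem dense_nonzeroPoints : Dense (nonzeroPoints n) := by
  rw [nonzeroPoints_eq_pi]
  exact dense_pi _ fun _ _ => dense_compl_singleton 0

theorem isComplexModel [Countable Q] : IsComplexModel n (⊤ : Opens (Fin n → ℂ))
    (Multiplicative (vertexGroup X Q hX f.facets)) := by
  have : Countable (Multiplicative (vertexGroup X Q hX f.facets)) := f.countable_vertexGroup hX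
  refine isComplexModel_top (fun g => ⟨fun z i => (Additive.toMul (torusExp d (g.toAdd : Torus d))
    (f.facets i) : ℂ) * z i, ?_, fun z => rfl⟩) isConnected_nonzeroPoints dense_nonzeroPoints
    fun z hz g hg => eq_one_of_vertexAction hX f.facets_injective hz hg
  fun_prop

/-- The chart at a vertex. -/
def chart [Countable Q] : Chart n (ToricSpace Δ X lam Q hX) :=
  Chart.ofOpenMap (f.isComplexModel hX) (fun z => f.toToric hX (z : Fin n → ℂ))
    ((f.continuous_toToric hX).comp continuous_subtype_val)
    ((f.isOpenMap_toToric hX).comp (⊤ : Opens (Fin n → ℂ)).isOpen.isOpenMap_subtype_val) (by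
      intro v w
      rw [toToric, toToric, toricSpace_mk_eq_iff, MulAction.mem_orbit_iff]
      have hr := f.facets_injective
      constructor
      · rintro ⟨t, ht, h⟩
        replace h : t +ᵥ slice f.facets (w : Fin n → ℂ) = slice f.facets (v : Fin n → ℂ) := h
        -- A torus element carrying one slice point to another preserves the coordinates equal to 1,
        -- so it fixes the base point.
        have hs : t ∈ AddAction.stabilizer (Torus d) (slice f.facets (0 : Fin n → ℂ)) := by
          refine (mem_stabilizer_slice_zero hr).2 fun j hj => ?_
          have := congrFun h j
          rwa [torus_vadd_apply, slice_apply_of_notMem _ hj, slice_apply_of_notMem _ hj,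
            mul_one] at this
        refine ⟨Multiplicative.ofAdd ⟨t, hs, ht⟩, Subtype.ext (funext fun i => ?_)⟩
        have := congrFun h (f.facets i)
        rwa [torus_vadd_apply, slice_apply hr, slice_apply hr] at this
      · rintro ⟨g, rfl⟩
        exact ⟨_, g.toAdd.2.2, (slice_vertexAction hX hr g w).symm⟩)

theorem mem_target_chart [Countable Q] {m : ToricSpace Δ X lam Q hX} :
    m ∈ (f.chart hX).target ↔ m ∈ Set.range (f.toToric hX) :=
  ⟨fun ⟨z, hz⟩ => ⟨z, hz⟩, fun ⟨z, hz⟩ => ⟨⟨z, trivial⟩, hz⟩⟩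

theorem isVertexChart_chart [Countable Q] :
    IsVertexChart Δ X lam Q hX f.vertex (f.chart hX) := by
  refine ⟨f.facets, f.facets_injective, f.range_facets, rfl, ?_, ⟨MulEquiv.refl _, fun g z => ?_⟩,
    fun z => ⟨f.slice_mem _, rfl⟩⟩
  · rw [← range_toToric]
    ext m
    exact f.mem_target_chart hX
  · exact slice_vertexAction hX f.facets_injective g z

end VertexFrame

end Torus

/-! ### Exponential covers -/

section ExpCover

variable {n : ℕ}

open Classical in
/-- The map of `ℂ^n` to itself that is `w ↦ exp (2πi w)` in the coordinates in `S` and the identity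
in the other ones. -/
def partialExp (S : Set (Fin n)) (w : Fin n → ℂ) (i : Fin n) : ℂ :=
  if i ∈ S then expTwoPiI (w i) else w i

variable {S : Set (Fin n)}

theorem partialExp_of_mem {i : Fin n} (hi : i ∈ S) (w : Fin n → ℂ) :
    partialExp S w i = expTwoPiI (w i) := if_pos hi

theorem partialExp_of_notMem {i : Fin n} (hi : i ∉ S) (w : Fin n → ℂ) :
    partialExp S w i = w i := if_neg hi

theorem partialExp_ne_zero {w : Fin n → ℂ} {i : Fin n} (hw : i ∉ S → w i ≠ 0) :
    partialExp S w i ≠ 0 := by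
  by_cases hi : i ∈ S
  · rw [partialExp_of_mem hi]
    exact expTwoPiI_ne_zero _
  · rw [partialExp_of_notMem hi]
    exact hw hi

theorem differentiable_partialExp : Differentiable ℂ (partialExp S) := by
  refine differentiable_pi.2 fun i => ?_
  by_cases hi : i ∈ S
  · simp only [partialExp_of_mem hi]
    exact differentiable_expTwoPiI.comp (differentiable_apply i)
  · simp only [partialExp_of_notMem hi]
    exact differentiable_apply i

theorem isOpenMap_expTwoPiI : IsOpenMap expTwoPiI :=
  Complex.isOpenMap_exp.comp (Homeomorph.mulLeft₀ _ Complex.two_pi_I_ne_zero).isOpenMap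

theorem isOpenMap_partialExp : IsOpenMap (partialExp S) := by
  classical
  have : partialExp S = Pi.map fun i => if i ∈ S then expTwoPiI else id := by
    funext w i
    by_cases hi : i ∈ S
    · simp [partialExp_of_mem hi, hi]
    · simp [partialExp_of_notMem hi, hi]
  rw [this]
  refine IsOpenMap.piMap (fun i => ?_) (by simp)
  split_ifs
  · exact isOpenMap_expTwoPiI
  · exact IsOpenMap.id

theorem partialExp_eq_iff {v w : Fin n → ℂ} : partialExp S v = partialExp S w ↔
    ∀ i, (i ∈ S → ∃ m : ℤ, v i = w i + m) ∧ (i ∉ S → v i = w i) := by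
  rw [funext_iff]
  refine forall_congr' fun i => ?_
  by_cases hi : i ∈ S
  · simp [partialExp_of_mem hi, hi, expTwoPiI_eq_iff]
  · simp [partialExp_of_notMem hi, hi]

/-- The group of deck transformations of `partialExp S`. -/
def partialLattice (S : Set (Fin n)) : AddSubgroup (Fin n → ℂ) where
  carrier := {m | ∀ i, (i ∈ S → ∃ k : ℤ, m i = k) ∧ (i ∉ S → m i = 0)}
  zero_mem' i := ⟨fun _ => ⟨0, by simp⟩, fun _ => rfl⟩
  add_mem' {a b} ha hb i := ⟨fun hi => by
    obtain ⟨k, hk⟩ := (ha i).1 hi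
    obtain ⟨l, hl⟩ := (hb i).1 hi
    exact ⟨k + l, by simp [hk, hl]⟩, fun hi => by simp [(ha i).2 hi, (hb i).2 hi]⟩
  neg_mem' {a} ha i := ⟨fun hi => by
    obtain ⟨k, hk⟩ := (ha i).1 hi
    exact ⟨-k, by simp [hk]⟩, fun hi => by simp [(ha i).2 hi]⟩

/-- A coordinate of a lattice vector is an integer, so the open unit ball contains only the zero
vector. -/
theorem discreteTopology_partialLattice : DiscreteTopology (partialLattice S) := by
  refine discreteTopology_of_isOpen_singleton_zero ?_
  have : ({0} : Set (partialLattice S)) = Subtype.val ⁻¹' Metric.ball (0 : Fin n → ℂ) 1 := by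
    ext ⟨m, hm⟩
    rw [Set.mem_singleton_iff, Set.mem_preimage, mem_ball_zero_iff, Subtype.ext_iff]
    constructor
    · intro h
      replace h : m = 0 := h
      change ‖m‖ < 1
      simp [h]
    · intro h
      refine funext fun i => ?_
      by_cases hi : i ∈ S
      · obtain ⟨k, hk⟩ := (hm i).1 hi
        have h1 := (norm_le_pi_norm m i).trans_lt h
        rw [hk, Complex.norm_intCast] at h1
        have h2 : k = 0 := Int.abs_lt_one_iff.1 (by exact_mod_cast h1)
        change m i = 0
        rw [hk, h2, Int.cast_zero]
      · exact (hm i).2 hi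
  rw [this]
  exact Metric.isOpen_ball.preimage continuous_subtype_val

variable {U : Opens (⊤ : Opens (Fin n → ℂ))}
  (hU : ∀ z : (⊤ : Opens (Fin n → ℂ)), z ∈ U ↔ ∀ i ∈ S, (z : Fin n → ℂ) i ≠ 0)

include hU in
theorem partialExp_mem (w : Fin n → ℂ) : (⟨partialExp S w, trivial⟩ : (⊤ : Opens _)) ∈ U :=
  (hU _).2 fun _ hi => partialExp_ne_zero fun h => absurd hi h

/-- `partialExp S` with its codomain restricted to the set where the coordinates in `S` do not
vanish. -/
def partialExpProj (w : Fin n → ℂ) : U := ⟨⟨partialExp S w, trivial⟩, partialExp_mem hU w⟩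

theorem partialExpProj_surjective : Function.Surjective (partialExpProj hU) := by
  rintro ⟨⟨z, hz⟩, hzU⟩
  have h : ∀ i, ∃ w, (i ∈ S → expTwoPiI w = z i) ∧ (i ∉ S → w = z i) := by
    intro i
    by_cases hi : i ∈ S
    · obtain ⟨w, hw⟩ := exists_expTwoPiI_eq ((hU _).1 hzU i hi)
      exact ⟨w, fun _ => hw, fun h => absurd hi h⟩
    · exact ⟨z i, fun h => absurd h hi, fun _ => rfl⟩
  choose w hw using h
  refine ⟨w, Subtype.ext (Subtype.ext (funext fun i => ?_))⟩
  change partialExp S w i = z i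
  by_cases hi : i ∈ S
  · rw [partialExp_of_mem hi, (hw i).1 hi]
  · rw [partialExp_of_notMem hi, (hw i).2 hi]

/-- It is an open continuous surjection whose fibres are the cosets of the discrete subgroup
`partialLattice S`. -/
theorem isCoveringMap_partialExpProj : IsCoveringMap (partialExpProj hU) := by
  have hemb : Topology.IsOpenEmbedding fun z : U => ((z : (⊤ : Opens (Fin n → ℂ))) : Fin n → ℂ) :=
    (⊤ : Opens (Fin n → ℂ)).isOpenEmbedding'.comp U.isOpenEmbedding'
  have hopen : IsOpenMap (partialExpProj hU) := hemb.isOpenMap_iff.2 isOpenMap_partialExp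
  have hcont : Continuous (partialExpProj hU) :=
    hemb.continuous_iff.2 differentiable_partialExp.continuous
  have hd : DiscreteTopology (partialLattice S) := discreteTopology_partialLattice
  refine ((hopen.isQuotientMap hcont
    (partialExpProj_surjective hU)).isAddQuotientCoveringMap_of_addSubgroup (partialLattice S)
      ⟨hd⟩ ?_).isCoveringMap
  intro v w
  rw [Subtype.ext_iff, Subtype.ext_iff]
  change partialExp S v = partialExp S w ↔ _
  rw [eq_comm, partialExp_eq_iff]
  refine forall_congr' fun i => and_congr (forall_congr' fun _ => exists_congr fun m => ?_)
    (forall_congr' fun _ => ?_)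
  · simp only [Pi.add_apply, Pi.neg_apply]
    constructor <;> intro h <;> linear_combination h
  · simp only [Pi.add_apply, Pi.neg_apply]
    constructor <;> intro h <;> linear_combination h

/-- The universal cover by `ℂ^n` of the set where the coordinates in `S` do not vanish. -/
def expCover : UniversalCover n U where
  total := Fin n → ℂ
  isManifold := inferInstance
  simplyConnected := inferInstance
  proj := partialExpProj hU
  isCovering := isCoveringMap_partialExpProj hU
  surjective := partialExpProj_surjective hU
  holomorphic := mdifferentiable_subtypeVal_comp_iff.1
    (mdifferentiable_subtypeVal_comp_iff.1 differentiable_partialExp.mdifferentiable)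

/-- The points `w` of ℂ^n without zero coordinates form a connected dense set lying over free
points. For coordinates in `S` the condition is superfluous but harmless. -/
theorem isComplexModel_expCover {G : Type} [Group G] [MulAction G (⊤ : Opens (Fin n → ℂ))]
    (hG : IsComplexModel n (⊤ : Opens (Fin n → ℂ)) G)
    (free : ∀ z : (⊤ : Opens (Fin n → ℂ)), (∀ i, (z : Fin n → ℂ) i ≠ 0) → ∀ g : G,
      g • z = z → g = 1) :
    IsComplexModel n (expCover hU).total (liftGroup G U (expCover hU)) := by
  have : T2Space (expCover hU).total := inferInstanceAs (T2Space (Fin n → ℂ))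
  have : SecondCountableTopology (expCover hU).total :=
    inferInstanceAs (SecondCountableTopology (Fin n → ℂ))
  refine isComplexModel_liftGroup hG VertexFrame.isConnected_nonzeroPoints
    VertexFrame.dense_nonzeroPoints fun w hw => ?_
  refine (Subgroup.eq_bot_iff_forall _).2 fun g hg => free _ (fun i => ?_) g hg
  exact partialExp_ne_zero fun _ => hw i

end ExpCover

/-! ### Changes of charts -/

namespace VertexFrame

variable {E : Type*} [AddCommGroup E] [Module ℝ E] {n d : ℕ} {Δ : Set (Module.Dual ℝ E)}
  {X : Fin d → E} {lam : Fin d → ℝ} {Q : AddSubgroup E} (hX : ∀ j, X j ∈ Q)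
  (f f' : VertexFrame n Δ X lam)

theorem lift_sub (v w : ℂ ⊗[ℝ] E) : f.lift (v - w) = f.lift v - f.lift w := by
  funext j
  by_cases hj : j ∈ Set.range f.facets
  · obtain ⟨i, rfl⟩ := hj
    simp [lift_apply]
  · simp [f.lift_apply_of_notMem _ hj]

/-- By linear independence of the normals at the vertex, a vector supported on its facets is
recovered from its projection. -/
theorem lift_complexProj {u : Fin d → ℂ} (hu : ∀ j ∉ Set.range f.facets, u j = 0) :
    f.lift (complexProj X u) = u := by
  have h : complexProj X u = ∑ i, u (f.facets i) • (1 : ℂ) ⊗ₜ[ℝ] f.basis i := by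
    rw [complexProj_apply]
    refine (Fintype.sum_of_injective f.facets f.facets_injective _ _ (fun j hj => ?_)
      fun i => ?_).symm
    · rw [hu j hj, zero_smul]
    · rw [f.basis_apply]
  funext j
  by_cases hj : j ∈ Set.range f.facets
  · obtain ⟨i, rfl⟩ := hj
    rw [f.lift_apply, h, map_sum]
    simp [complexCoords_tmul]
  · rw [f.lift_apply_of_notMem _ hj, hu j hj]

/-- The facets of `f` that do not belong to `f'`. -/
def newFacets : Set (Fin n) := {i | f.facets i ∉ Set.range f'.facets}

open Classical in
/-- The coordinates of `w` at the facets of `f` that do not belong to `f'`, as a vector of `ℂ^d`. -/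
def newPart (w : Fin n → ℂ) (j : Fin d) : ℂ :=
  if j ∈ Set.range f'.facets then 0 else Function.extend f.facets w 0 j

/-- The logarithm of the element of `N_ℂ` used in the change of charts from `f` to `f'`. -/
def angle (w : Fin n → ℂ) : Fin d → ℂ := f'.lift (complexProj X (newPart f f' w))

open Classical in
/-- The change of charts from `f` to `f'` on the universal covers of the overlaps. -/
def transition (w : Fin n → ℂ) (k : Fin n) : ℂ :=
  if f'.facets k ∈ Set.range f.facets then
    expTwoPiI (angle f f' w (f'.facets k)) * Function.extend f.facets w 0 (f'.facets k)
  else angle f f' w (f'.facets k)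

variable {f f'}

theorem newPart_of_mem (w : Fin n → ℂ) {j : Fin d} (hj : j ∈ Set.range f'.facets) :
    newPart f f' w j = 0 := if_pos hj

theorem newPart_facets (w : Fin n → ℂ) {i : Fin n} (hi : f.facets i ∉ Set.range f'.facets) :
    newPart f f' w (f.facets i) = w i := by
  rw [newPart, if_neg hi, f.facets_injective.extend_apply]

theorem newPart_of_notMem (w : Fin n → ℂ) {j : Fin d} (hj : j ∉ Set.range f.facets) :
    newPart f f' w j = 0 := by
  rw [newPart, Function.extend_apply' _ _ _ hj, Pi.zero_apply, ite_self]

theorem angle_of_notMem (w : Fin n → ℂ) {j : Fin d} (hj : j ∉ Set.range f'.facets) :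
    angle f f' w j = 0 := f'.lift_apply_of_notMem _ hj

theorem complexProj_angle (w : Fin n → ℂ) :
    complexProj X (angle f f' w) = complexProj X (newPart f f' w) := f'.complexProj_lift _

theorem transition_of_notMem (w : Fin n → ℂ) {k : Fin n}
    (hk : f'.facets k ∉ Set.range f.facets) :
    transition f f' w k = angle f f' w (f'.facets k) := if_neg hk

theorem transition_of_eq (w : Fin n → ℂ) {i k : Fin n} (h : f'.facets k = f.facets i) :
    transition f f' w k = expTwoPiI (angle f f' w (f.facets i)) * w i := by
  rw [transition, if_pos ⟨i, h.symm⟩, h, f.facets_injective.extend_apply]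

/-- The new part of the transformed point is the old angle minus its restriction `Z` to the facets
of `f`. The angle and the old new part have the same projection, so lifting back to `f` gives the
old new part minus `Z`. Thus the element of N_ℂ for the return trip is the inverse of the first one.
-/
theorem angle_transition (w : Fin n → ℂ) (i : Fin n) :
    angle f' f (transition f f' w) (f.facets i) =
      newPart f f' w (f.facets i) - angle f f' w (f.facets i) := by
  classical
  let Z : Fin d → ℂ := fun j => if j ∈ Set.range f.facets then angle f f' w j else 0
  have h : newPart f' f (transition f f' w) = angle f f' w - Z := by
    funext j
    by_cases hj : j ∈ Set.range f.facets
    · have : Z j = angle f f' w j := if_pos hj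
      rw [newPart_of_mem _ hj, Pi.sub_apply, this, sub_self]
    · have : Z j = 0 := if_neg hj
      rw [Pi.sub_apply, this, sub_zero]
      by_cases hj' : j ∈ Set.range f'.facets
      · obtain ⟨k, rfl⟩ := hj'
        rw [newPart_facets _ hj, transition_of_notMem _ hj]
      · rw [newPart_of_notMem _ hj', angle_of_notMem _ hj']
  have hZ : Z (f.facets i) = angle f f' w (f.facets i) := if_pos ⟨i, rfl⟩
  rw [angle, h, map_sub, complexProj_angle, lift_sub,
    f.lift_complexProj fun j hj => newPart_of_notMem w hj,
    f.lift_complexProj (u := Z) fun j hj => if_neg hj, Pi.sub_apply, hZ]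

theorem transition_transition (w : Fin n → ℂ) : transition f' f (transition f f' w) = w := by
  funext i
  by_cases hi : f.facets i ∈ Set.range f'.facets
  · obtain ⟨k, hk⟩ := hi
    rw [transition_of_eq _ hk.symm, hk, angle_transition, newPart_of_mem _ ⟨k, hk⟩, zero_sub,
      transition_of_eq _ hk, ← mul_assoc, expTwoPiI_neg_mul_self, one_mul]
  · rw [transition_of_notMem _ hi, angle_transition, newPart_facets _ hi, angle_of_notMem _ hi,
      sub_zero]

theorem differentiable_extend_apply (r : Fin n → Fin d) (j : Fin d) :
    Differentiable ℂ fun w : Fin n → ℂ => Function.extend r w (0 : Fin d → ℂ) j := by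
  by_cases hj : ∃ i, r i = j
  · simp only [Function.extend_def, hj, dif_pos]
    exact differentiable_apply _
  · simp only [Function.extend_def, hj, dif_neg, not_false_eq_true]
    exact differentiable_const _

theorem differentiable_complexCoords_comp {F : Type*} [NormedAddCommGroup F] [NormedSpace ℂ F]
    (B : Module.Basis (Fin n) ℝ E) (k : Fin n) {u : F → Fin d → ℂ} (hu : Differentiable ℂ u) :
    Differentiable ℂ fun w => complexCoords B (complexProj X (u w)) k :=
  (LinearMap.toContinuousLinearMap
    (LinearMap.proj (R := ℂ) (φ := fun _ : Fin n => ℂ) k ∘ₗ (complexCoords B).toLinearMap ∘ₗ complexProj X)).differentiable.comp hu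

variable (f f') in
theorem differentiable_transition : Differentiable ℂ (transition f f') := by
  have h1 : Differentiable ℂ (newPart f f') := by
    refine differentiable_pi.2 fun j => ?_
    by_cases hj : j ∈ Set.range f'.facets
    · simp only [newPart_of_mem _ hj]
      exact differentiable_const _
    · simp only [newPart, hj, if_false]
      exact differentiable_extend_apply _ _
  have h2 : ∀ k, Differentiable ℂ fun w => angle f f' w (f'.facets k) := by
    intro k
    simp only [angle, lift_apply]
    exact differentiable_complexCoords_comp _ _ h1
  refine differentiable_pi.2 fun k => ?_
  by_cases hk : f'.facets k ∈ Set.range f.facets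
  · simp only [transition, hk, if_true]
    exact (differentiable_expTwoPiI.comp (h2 k)).mul (differentiable_extend_apply _ _)
  · simp only [transition, hk, if_false]
    exact h2 k

theorem toToric_transition (w : Fin n → ℂ) :
    f'.toToric hX (partialExp (newFacets f' f) (transition f f' w)) =
      f.toToric hX (partialExp (newFacets f f') w) := by
  rw [toToric, toToric, toricSpace_mk_eq_iff]
  -- Subtracting `newPart` turns the coordinates at facets of `f` outside `f'` into 1. Adding
  -- `angle` restores a vanishing projection; at facets of `f'` outside `f` it replaces the
  -- coordinate 1 by the exponential of the angle.
  refine ⟨QuotientAddGroup.mk (angle f f' w - newPart f f' w), ?_, funext fun j => ?_⟩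
  · rw [mk_mem_kernelGroup_iff]
    exact ⟨0, Q.zero_mem, by rw [map_sub, complexProj_angle, sub_self, TensorProduct.tmul_zero]⟩
  change expTwoPiI ((angle f f' w - newPart f f' w) j) * slice f.facets _ j = slice f'.facets _ j
  by_cases hj' : j ∈ Set.range f'.facets
  · rw [Pi.sub_apply, newPart_of_mem _ hj', sub_zero]
    obtain ⟨k, rfl⟩ := hj'
    rw [slice_apply f'.facets_injective]
    by_cases hj : f'.facets k ∈ Set.range f.facets
    · obtain ⟨i, hi⟩ := hj
      rw [partialExp_of_notMem (fun h : k ∈ newFacets f' f => h ⟨i, hi⟩), transition_of_eq _ hi.symm, ← hi,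
        slice_apply f.facets_injective, partialExp_of_notMem (fun h : i ∈ newFacets f f' => h ⟨k, hi.symm⟩)]
    · rw [partialExp_of_mem hj, transition_of_notMem _ hj, slice_apply_of_notMem _ hj, mul_one]
  · rw [Pi.sub_apply, angle_of_notMem _ hj', zero_sub, slice_apply_of_notMem _ hj']
    by_cases hj : j ∈ Set.range f.facets
    · obtain ⟨i, rfl⟩ := hj
      rw [newPart_facets _ hj', slice_apply f.facets_injective, partialExp_of_mem hj']
      exact expTwoPiI_neg_mul_self _
    · rw [newPart_of_notMem _ hj, slice_apply_of_notMem _ hj, neg_zero, mul_one]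
      exact expTwoPiI_zero

theorem toToric_mem_range_iff (u : Fin n → ℂ) :
    f.toToric hX u ∈ Set.range (f'.toToric hX) ↔
      ∀ j ∉ Set.range f'.facets, slice f.facets u j ≠ 0 :=
  f'.mk_mem_range_toToric_iff hX

variable (f f') in
/-- The overlap of the charts at two vertices, seen in the first one. -/
def chartOverlap [Countable Q] : Opens (⊤ : Opens (Fin n → ℂ)) :=
  (f.chart hX).overlap (f'.chart hX)

theorem mem_chartOverlap [Countable Q] (z : (⊤ : Opens (Fin n → ℂ))) :
    z ∈ chartOverlap hX f f' ↔ ∀ i ∈ newFacets f f', (z : Fin n → ℂ) i ≠ 0 := by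
  change f.toToric hX z ∈ (f'.chart hX).target ↔ _
  rw [mem_target_chart, toToric_mem_range_iff]
  constructor
  · intro h i hi
    have := h _ hi
    rwa [slice_apply f.facets_injective] at this
  · intro h j hj
    by_cases hjf : j ∈ Set.range f.facets
    · obtain ⟨i, rfl⟩ := hjf
      rw [slice_apply f.facets_injective]
      exact h i hj
    · rw [slice_apply_of_notMem _ hjf]
      exact one_ne_zero

theorem isComplexModel_chartOverlap [Countable Q] :
    IsComplexModel n (expCover (mem_chartOverlap hX (f := f) (f' := f'))).total
      (liftGroup (Multiplicative (vertexGroup X Q hX f.facets)) (chartOverlap hX f f')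
        (expCover (mem_chartOverlap hX))) :=
  isComplexModel_expCover _ (f.isComplexModel hX)
    fun _ hz _ hg => eq_one_of_vertexAction hX f.facets_injective hz hg

variable (f f') in
/-- The biholomorphism of universal covers given by `transition`. -/
def transitionEquiv : (Fin n → ℂ) ≃ (Fin n → ℂ) where
  toFun := transition f f'
  invFun := transition f' f
  left_inv := transition_transition
  right_inv := transition_transition

variable (f f') in
theorem compatible_chart [Countable Q] : (f.chart hX).Compatible (f'.chart hX) := fun _ =>
  ⟨expCover (mem_chartOverlap hX (f := f) (f' := f')),
    expCover (mem_chartOverlap hX (f := f') (f' := f)),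
    isComplexModel_chartOverlap hX, isComplexModel_chartOverlap hX, transitionEquiv f f',
    (differentiable_transition f f').mdifferentiable,
    (differentiable_transition f' f).mdifferentiable, toToric_transition hX⟩

end VertexFrame

/-! ### Quasilattices and coordinates on the complexification -/

section Quasitorus

variable {E : Type*} [AddCommGroup E] [Module ℝ E] {n d : ℕ}

theorem IsQuasilattice.countable {Q : AddSubgroup E} (hQ : IsQuasilattice Q) : Countable Q := by
  obtain ⟨s, -, rfl⟩ := hQ
  rw [← Submodule.span_int_eq_addSubgroupClosure]
  have : Module.Finite ℤ (Submodule.span ℤ (s : Set E)) := inferInstance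
  exact Finsupp.Countable.of_moduleFinite (R := ℤ) (M := Submodule.span ℤ (s : Set E))

theorem complexCoords_one_tmul (b : Module.Basis (Fin n) ℝ E) (x : E) (i : Fin n) :
    complexCoords b ((1 : ℂ) ⊗ₜ[ℝ] x) i = (b.repr x i : ℂ) := by
  change (b.baseChange ℂ).repr _ i = _
  rw [Module.Basis.baseChange_repr_tmul]
  simp

theorem complexCoords_symm_apply (b : Module.Basis (Fin n) ℝ E) (z : Fin n → ℂ) :
    (complexCoords b).symm z = ∑ i, z i ⊗ₜ[ℝ] b i := by
  rw [← sum_complexCoords b ((complexCoords b).symm z)]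
  refine Finset.sum_congr rfl fun i _ => ?_
  rw [LinearEquiv.apply_symm_apply, TensorProduct.smul_tmul', smul_eq_mul, mul_one]

/-! ### The complex quasitorus -/

variable (b : Module.Basis (Fin n) ℝ E) (Q : AddSubgroup E)

/-- The quasilattice `Q` in the coordinates of a basis. -/
def coordLattice : AddSubgroup (Fin n → ℝ) :=
  Q.map (b.equivFun : E →ₗ[ℝ] Fin n → ℝ).toAddMonoidHom

/-- The group `Q` and its copy in coordinates are isomorphic. -/
def coordLatticeEquiv : Q ≃+ coordLattice b Q :=
  Q.equivMapOfInjective _ b.equivFun.injective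

theorem coordLatticeEquiv_apply (q : Q) (i : Fin n) :
    (coordLatticeEquiv b Q q : Fin n → ℝ) i = b.repr (q : E) i := rfl

instance translationAction (L : AddSubgroup (Fin n → ℝ)) :
    MulAction (Multiplicative L) (⊤ : Opens (Fin n → ℂ)) where
  smul g z := ⟨fun i => (z : Fin n → ℂ) i + ((g.toAdd : Fin n → ℝ) i : ℂ), trivial⟩
  one_smul z := by
    refine Subtype.ext (funext fun i => ?_)
    change (z : Fin n → ℂ) i + ((0 : ℝ) : ℂ) = (z : Fin n → ℂ) i
    simp
  mul_smul g h z := by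
    refine Subtype.ext (funext fun i => ?_)
    change (z : Fin n → ℂ) i + (((g.toAdd : Fin n → ℝ) i + (h.toAdd : Fin n → ℝ) i : ℝ) : ℂ) =
      (z : Fin n → ℂ) i + ((h.toAdd : Fin n → ℝ) i : ℂ) + ((g.toAdd : Fin n → ℝ) i : ℂ)
    push_cast
    ring

theorem translationAction_apply (L : AddSubgroup (Fin n → ℝ)) (g : Multiplicative L)
    (z : (⊤ : Opens (Fin n → ℂ))) (i : Fin n) :
    ((g • z : (⊤ : Opens (Fin n → ℂ))) : Fin n → ℂ) i =
      (z : Fin n → ℂ) i + ((g.toAdd : Fin n → ℝ) i : ℂ) := rfl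

theorem isComplexModel_translation (L : AddSubgroup (Fin n → ℝ)) [Countable L] :
    IsComplexModel n (⊤ : Opens (Fin n → ℂ)) (Multiplicative L) := by
  have : Countable (Multiplicative L) := ‹Countable L›
  refine isComplexModel_top (fun g => ⟨fun z i => z i + ((g.toAdd : Fin n → ℝ) i : ℂ), ?_,
    fun z => rfl⟩) isConnected_univ dense_univ fun z _ g hg => ?_
  · fun_prop
  · refine Multiplicative.toAdd.injective (Subtype.ext (funext fun i => ?_))
    have := congrFun (congrArg Subtype.val hg) i
    rw [translationAction_apply, add_eq_left, Complex.ofReal_eq_zero] at this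
    exact this

/-- The exponential mapping of the quasitorus in coordinates. -/
def quasitorusParam (z : Fin n → ℂ) : Quasitorus Q := Quasitorus.mk Q ((complexCoords b).symm z)

variable {b Q} in
theorem quasitorusParam_eq_iff {v w : Fin n → ℂ} :
    quasitorusParam b Q v = quasitorusParam b Q w ↔
      ∃ q ∈ Q, ∀ i, v i = w i + (b.repr q i : ℂ) := by
  rw [quasitorusParam, quasitorusParam, ← sub_eq_zero, ← map_sub, ← map_sub,
    quasitorus_mk_eq_zero_iff]
  refine exists_congr fun q => and_congr_right fun _ => ?_
  rw [LinearEquiv.eq_symm_apply, funext_iff]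
  refine forall_congr' fun i => ?_
  rw [complexCoords_one_tmul, Pi.sub_apply, eq_sub_iff_add_eq, eq_comm, add_comm]

theorem continuous_quasitorusParam : Continuous (quasitorusParam b Q) := by
  let _ : TopologicalSpace (ℂ ⊗[ℝ] E) := moduleTopology ℂ (ℂ ⊗[ℝ] E)
  have : IsModuleTopology ℂ (ℂ ⊗[ℝ] E) := ⟨rfl⟩
  have : ContinuousAdd (ℂ ⊗[ℝ] E) := IsModuleTopology.toContinuousAdd ℂ _
  have h1 : Continuous (Quasitorus.mk Q) := continuous_coinduced_rng
  exact h1.comp (IsModuleTopology.continuous_of_linearMap (complexCoords b).symm.toLinearMap)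

/-- The saturation of an open set is the union of its translates by `Q`. -/
theorem isOpenMap_quasitorusParam : IsOpenMap (quasitorusParam b Q) := by
  intro U hU
  let _ : TopologicalSpace (ℂ ⊗[ℝ] E) := moduleTopology ℂ (ℂ ⊗[ℝ] E)
  have : IsModuleTopology ℂ (ℂ ⊗[ℝ] E) := ⟨rfl⟩
  have hc : Continuous (complexCoords b) :=
    IsModuleTopology.continuous_of_linearMap (complexCoords b).toLinearMap
  have h : Quasitorus.mk Q ⁻¹' (quasitorusParam b Q '' U) = complexCoords b ⁻¹'
      ⋃ q : Q, (fun z i => z i + (b.repr (q : E) i : ℂ)) ⁻¹' U := by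
    ext v
    have hv : Quasitorus.mk Q v = quasitorusParam b Q (complexCoords b v) := by
      rw [quasitorusParam, LinearEquiv.symm_apply_apply]
    rw [Set.mem_preimage, hv, Set.mem_preimage, Set.mem_iUnion]
    constructor
    · rintro ⟨u, hu, huv⟩
      obtain ⟨q, hq, h⟩ := quasitorusParam_eq_iff.1 huv
      refine ⟨⟨q, hq⟩, ?_⟩
      rw [Set.mem_preimage]
      convert hu using 1
      exact funext fun i => (h i).symm
    · rintro ⟨q, hq⟩
      exact ⟨_, hq, quasitorusParam_eq_iff.2 ⟨q, q.2, fun i => rfl⟩⟩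
  refine isOpen_coinduced.2 ?_
  rw [h]
  refine (isOpen_iUnion fun q => hU.preimage ?_).preimage hc
  fun_prop

theorem quasitorusParam_surjective : Function.Surjective (quasitorusParam b Q) :=
  (QuotientAddGroup.mk'_surjective (complexLattice Q)).comp (complexCoords b).symm.surjective

/-- The chart of the complex quasitorus. -/
def quasitorusChart [Countable Q] : Chart n (Quasitorus Q) :=
  have : Countable (coordLattice b Q) := (coordLatticeEquiv b Q).symm.injective.countable
  -- The group of a chart must live in `Type`, whereas `E` may lie in any universe; hence the copy
  -- of `Q` inside ℝ^n.
  Chart.ofOpenMap (isComplexModel_translation (coordLattice b Q))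
    (fun z => quasitorusParam b Q (z : Fin n → ℂ))
    ((continuous_quasitorusParam b Q).comp continuous_subtype_val)
    ((isOpenMap_quasitorusParam b Q).comp (⊤ : Opens (Fin n → ℂ)).isOpen.isOpenMap_subtype_val) (by
      intro v w
      rw [quasitorusParam_eq_iff, MulAction.mem_orbit_iff]
      constructor
      · rintro ⟨q, hq, h⟩
        exact ⟨Multiplicative.ofAdd (coordLatticeEquiv b Q ⟨q, hq⟩),
          Subtype.ext (funext fun i => (h i).symm)⟩
      · rintro ⟨g, rfl⟩
        obtain ⟨q, hq⟩ := (coordLatticeEquiv b Q).surjective g.toAdd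
        refine ⟨q, q.2, fun i => ?_⟩
        rw [translationAction_apply, ← hq, coordLatticeEquiv_apply])

theorem target_quasitorusChart [Countable Q] : (quasitorusChart b Q).target = ⊤ := by
  refine SetLike.coe_injective (Set.eq_univ_of_forall fun m => ?_)
  obtain ⟨z, rfl⟩ := quasitorusParam_surjective b Q m
  exact ⟨⟨z, trivial⟩, rfl⟩

theorem isQuasitorusChart_quasitorusChart [Countable Q] :
    IsQuasitorusChart Q (quasitorusChart b Q) := by
  refine ⟨b, rfl, target_quasitorusChart b Q,
    ⟨AddEquiv.toMultiplicative (coordLatticeEquiv b Q).symm, fun g z i => ?_⟩, fun z => ?_⟩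
  · obtain ⟨q, rfl⟩ := (AddEquiv.toMultiplicative (coordLatticeEquiv b Q)).surjective g
    refine (translationAction_apply _ _ _ _).trans ?_
    refine congrArg (fun x : Q => (z : Fin n → ℂ) i + (b.repr (x : E) i : ℂ)) ?_
    exact ((coordLatticeEquiv b Q).symm_apply_apply q.toAdd).symm
  · rw [← complexCoords_symm_apply]
    rfl

end Quasitorus

/-! ### The action of the quasitorus -/

section Action

variable {E : Type*} [AddCommGroup E] [Module ℝ E] {n d : ℕ} {Δ : Set (Module.Dual ℝ E)}
  {X : Fin d → E} {lam : Fin d → ℝ} {Q : AddSubgroup E} (hX : ∀ j, X j ∈ Q)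

theorem IsVertex.exists_frame [FiniteDimensional ℝ E] (hn : Module.finrank ℝ E = n)
    (hΔ : IsSimplePolytope n Δ) (hN : AreInwardNormals n Δ X lam) {μ : Module.Dual ℝ E}
    (hμ : IsVertex Δ μ) : ∃ f : VertexFrame n Δ X lam, f.vertex = μ := by
  obtain ⟨r, -, hr⟩ := hμ.exists_enumeration hn hΔ hN
  obtain ⟨B, hB⟩ := hμ.exists_basis hn hN hr
  exact ⟨⟨μ, hμ, hN.eq_inter, r, hr, B, hB⟩, rfl⟩

theorem exists_mem_range_toToric [FiniteDimensional ℝ E] (hn : Module.finrank ℝ E = n)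
    (hΔ : IsSimplePolytope n Δ) (hN : AreInwardNormals n Δ X lam) (m : ToricSpace Δ X lam Q hX) :
    ∃ f : VertexFrame n Δ X lam, m ∈ Set.range (f.toToric hX) := by
  obtain ⟨z, rfl⟩ := toricSpace_mk_surjective hX m
  obtain ⟨F, hF, hz⟩ := z.2
  obtain ⟨s, hs⟩ := hΔ.polytope
  obtain ⟨μ, hμF, hμ⟩ := hF.exists_isVertex hN.eq_inter hs
  obtain ⟨f, rfl⟩ := hμ.exists_frame hn hΔ hN
  refine ⟨f, (f.mk_mem_range_toToric_iff hX).2 fun j hj hj0 => hj ?_⟩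
  rw [f.range_facets]
  exact ((hz j).1 hj0 hμF).2

theorem exists_complexQuasifold_hasVertexCharts [FiniteDimensional ℝ E]
    (hn : Module.finrank ℝ E = n) (hΔ : IsSimplePolytope n Δ) (hN : AreInwardNormals n Δ X lam)
    [Countable Q] :
    ∃ 𝒜 : ComplexQuasifold n (ToricSpace Δ X lam Q hX), HasVertexCharts Δ X lam Q hX 𝒜 := by
  obtain ⟨𝒜, h𝒜⟩ := exists_complexQuasifold
    (Set.range fun f : VertexFrame n Δ X lam => f.chart hX)
    (fun m => by
      obtain ⟨f, hf⟩ := exists_mem_range_toToric hX hn hΔ hN m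
      exact ⟨_, ⟨f, rfl⟩, (f.mem_target_chart hX).2 hf⟩)
    (by
      rintro _ ⟨f, rfl⟩ _ ⟨f', rfl⟩
      exact f.compatible_chart hX f')
  refine ⟨𝒜, fun μ hμ => ?_, fun m => ?_⟩
  · obtain ⟨f, rfl⟩ := hμ.exists_frame hn hΔ hN
    exact ⟨_, h𝒜 ⟨f, rfl⟩, f.isVertexChart_chart hX⟩
  · obtain ⟨f, hf⟩ := exists_mem_range_toToric hX hn hΔ hN m
    exact ⟨f.vertex, f.isVertex, _, h𝒜 ⟨f, rfl⟩, f.isVertexChart_chart hX,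
      (f.mem_target_chart hX).2 hf⟩

theorem VertexFrame.torusProj_lift (f : VertexFrame n Δ X lam) (v : ℂ ⊗[ℝ] E) :
    torusProj X Q hX (QuotientAddGroup.mk (f.lift v)) = Quasitorus.mk Q v := by
  rw [torusProj_mk, f.complexProj_lift]

theorem VertexFrame.torusProj_surjective (f : VertexFrame n Δ X lam) :
    Function.Surjective (torusProj X Q hX) := by
  intro a
  obtain ⟨v, rfl⟩ := QuotientAddGroup.mk'_surjective (complexLattice Q) a
  exact ⟨_, f.torusProj_lift hX v⟩

/-- The action of the torus descends to an action of the quasitorus on the orbit space. -/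
theorem exists_quasitorus_action (hs : Function.Surjective (torusProj X Q hX)) :
    ∃ τ : Quasitorus Q × ToricSpace Δ X lam Q hX → ToricSpace Δ X lam Q hX,
      ∀ (t : Torus d) (z : faceOrbits Δ X lam),
        τ (torusProj X Q hX t, ToricSpace.mk hX z) = ToricSpace.mk hX (t +ᵥ z) := by
  choose s hs using hs
  choose u hu using toricSpace_mk_surjective (Δ := Δ) (lam := lam) hX
  refine ⟨fun p => ToricSpace.mk hX (s p.1 +ᵥ u p.2), fun t z => ?_⟩
  obtain ⟨k, hk, hkz⟩ := (toricSpace_mk_eq_iff hX).1 (hu (ToricSpace.mk hX z))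
  -- Two preimages of the same quasitorus element differ by the kernel N_ℂ, and `k` in N_ℂ accounts
  -- for the choice of representative of `[z]`.
  refine (toricSpace_mk_eq_iff hX).2 ⟨s (torusProj X Q hX t) - t + k, add_mem ?_ hk, ?_⟩
  · change torusProj X Q hX _ = 0
    rw [map_sub, hs, sub_self]
  · rw [SubAddAction.val_vadd, SubAddAction.val_vadd, ← hkz, vadd_vadd, vadd_vadd]
    congr 1
    abel

variable {τ : Quasitorus Q × ToricSpace Δ X lam Q hX → ToricSpace Δ X lam Q hX}
  (hτ : ∀ (t : Torus d) (z : faceOrbits Δ X lam),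
    τ (torusProj X Q hX t, ToricSpace.mk hX z) = ToricSpace.mk hX (t +ᵥ z))

theorem VertexFrame.lift_vadd_slice (f : VertexFrame n Δ X lam) (v : ℂ ⊗[ℝ] E) (w : Fin n → ℂ) :
    (QuotientAddGroup.mk (f.lift v) : Torus d) +ᵥ slice f.facets w =
      slice f.facets fun i => expTwoPiI (complexCoords f.basis v i) * w i := by
  funext j
  rw [torus_mk_vadd_apply]
  by_cases hj : j ∈ Set.range f.facets
  · obtain ⟨i, rfl⟩ := hj
    rw [slice_apply f.facets_injective, slice_apply f.facets_injective, f.lift_apply]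
  · rw [slice_apply_of_notMem _ hj, slice_apply_of_notMem _ hj, f.lift_apply_of_notMem _ hj,
      expTwoPiI_zero, one_mul]

-- A vector `v` of the complexification acts as the torus element `[lift v]`, which preserves the
-- slice and multiplies its coordinates by exponentials of the coordinates of `v`. So one vertex
-- chart serves both as source and as target.
include hτ in
theorem isHolomorphicOnProd_quasitorus_action [FiniteDimensional ℝ E]
    (hn : Module.finrank ℝ E = n) (hN : AreInwardNormals n Δ X lam)
    {𝒟 : ComplexQuasifold n (Quasitorus Q)} {𝒜 : ComplexQuasifold n (ToricSpace Δ X lam Q hX)}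
    (h𝒟 : ∃ c ∈ 𝒟.atlas, IsQuasitorusChart Q c) (h𝒜 : HasVertexCharts Δ X lam Q hX 𝒜) :
    IsHolomorphicOnProd 𝒟 𝒜 𝒜 τ := by
  refine isHolomorphicOnProd_of_lifts fun a m => ?_
  obtain ⟨c, hc, b, -, hct, -, hcs⟩ := h𝒟
  obtain ⟨μ, hμ, c', hc', ⟨r, hr, hrange, hdom, htarget, -, hspace⟩, hm⟩ := h𝒜.cover m
  -- The atlas is arbitrary, so the frame has to use the enumeration that comes with the given
  -- chart.
  obtain ⟨f, rfl⟩ : ∃ f : VertexFrame n Δ X lam, f.facets = r := by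
    obtain ⟨B, hB⟩ := hμ.exists_basis hn hN hrange
    exact ⟨⟨μ, hμ, hN.eq_inter, r, hrange, B, hB⟩, rfl⟩
  have hmem : ∀ x, x ∈ c'.domain := fun x => by rw [hdom]; trivial
  let G : (Fin n → ℂ) × (Fin n → ℂ) → Fin n → ℂ := fun p i =>
    expTwoPiI (complexCoords f.basis ((complexCoords b).symm p.1) i) * p.2 i
  have hG : Differentiable ℂ G := by
    refine differentiable_pi.2 fun i => ?_
    have h1 : Differentiable ℂ fun z : Fin n → ℂ =>
        complexCoords f.basis ((complexCoords b).symm z) i :=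
      (LinearMap.toContinuousLinearMap (LinearMap.proj (R := ℂ) (φ := fun _ : Fin n => ℂ) i ∘ₗ
        (complexCoords f.basis).toLinearMap ∘ₗ (complexCoords b).symm.toLinearMap)).differentiable
    have h2 : Differentiable ℂ fun p : (Fin n → ℂ) × (Fin n → ℂ) => p.2 i := by
      fun_prop
    exact (differentiable_expTwoPiI.comp (h1.comp differentiable_fst)).mul h2
  refine ⟨c, hc, c', hc', c', hc', hct ▸ trivial, hm, ?_,
    fun p => ⟨G (p.1, p.2), hmem _⟩, ?_, fun v w => ?_⟩
  · obtain ⟨z, hz, rfl⟩ := htarget.le hm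
    obtain ⟨t, rfl⟩ := f.torusProj_surjective hX a
    rw [hτ]
    refine htarget.ge ⟨t +ᵥ z, fun j hj => ?_, rfl⟩
    rw [SubAddAction.val_vadd, torus_vadd_apply]
    exact mul_ne_zero (Units.ne_zero _) (hz j hj)
  · refine mdifferentiable_subtypeVal_comp_iff.1 ?_
    exact hG.mdifferentiable.comp ((mdifferentiable_subtypeVal.comp mdifferentiable_fst).prodMk_space
      (mdifferentiable_subtypeVal.comp mdifferentiable_snd))
  · obtain ⟨h1, e1⟩ := hspace w
    obtain ⟨h2, e2⟩ := hspace ⟨G (v, w), hmem _⟩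
    rw [e1, e2, hcs, ← complexCoords_symm_apply, ← f.torusProj_lift hX, hτ]
    exact congrArg (ToricSpace.mk hX) (Subtype.ext (f.lift_vadd_slice _ _).symm)

include hτ in
theorem isHolomorphicAction_quasitorus_action [FiniteDimensional ℝ E]
    (hn : Module.finrank ℝ E = n) (hN : AreInwardNormals n Δ X lam)
    (hs : Function.Surjective (torusProj X Q hX))
    {𝒟 : ComplexQuasifold n (Quasitorus Q)} {𝒜 : ComplexQuasifold n (ToricSpace Δ X lam Q hX)}
    (h𝒟 : ∃ c ∈ 𝒟.atlas, IsQuasitorusChart Q c) (h𝒜 : HasVertexCharts Δ X lam Q hX 𝒜) :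
    IsHolomorphicAction 𝒟 𝒜 τ where
  add a b m := by
    obtain ⟨s, rfl⟩ := hs a
    obtain ⟨t, rfl⟩ := hs b
    obtain ⟨z, rfl⟩ := toricSpace_mk_surjective hX m
    rw [hτ, hτ, ← map_add, hτ, add_vadd]
  zero m := by
    obtain ⟨z, rfl⟩ := toricSpace_mk_surjective hX m
    rw [← map_zero (torusProj X Q hX), hτ, zero_vadd]
  holomorphic := isHolomorphicOnProd_quasitorus_action hX hτ hn hN h𝒟 h𝒜

-- The base point is the class of (1, …, 1), whose torus orbit is the set of all points with nonzero
-- coordinates.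
include hτ in
theorem VertexFrame.mem_range_quasitorus_action_iff (f : VertexFrame n Δ X lam)
    {x : faceOrbits Δ X lam} :
    ToricSpace.mk hX x ∈ Set.range (fun a => τ (a, f.toToric hX 1)) ↔
      ∀ j, (x : Fin d → ℂ) j ≠ 0 := by
  have hone : ∀ j, slice f.facets (1 : Fin n → ℂ) j = 1 := by
    intro j
    by_cases hj : j ∈ Set.range f.facets
    · obtain ⟨i, rfl⟩ := hj
      rw [slice_apply f.facets_injective, Pi.one_apply]
    · rw [slice_apply_of_notMem _ hj]
  constructor
  · rintro ⟨a, ha⟩ j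
    obtain ⟨t, rfl⟩ := f.torusProj_surjective hX a
    simp only [toToric, hτ] at ha
    obtain ⟨s, -, hs⟩ := (toricSpace_mk_eq_iff hX).1 ha.symm
    rw [← hs, SubAddAction.val_vadd, vadd_vadd, torus_vadd_apply]
    exact mul_ne_zero (Units.ne_zero _) ((hone j).trans_ne one_ne_zero)
  · intro hx
    choose Y hY using fun j => exists_expTwoPiI_eq (hx j)
    refine ⟨torusProj X Q hX (QuotientAddGroup.mk Y), ?_⟩
    simp only [toToric, hτ]
    congr 1
    refine Subtype.ext (funext fun j => ?_)
    rw [SubAddAction.val_vadd, torus_mk_vadd_apply, hY]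
    exact (congrArg _ (hone j)).trans (mul_one _)

include hτ in
theorem VertexFrame.isOpen_range_quasitorus_action (f : VertexFrame n Δ X lam) :
    IsOpen (Set.range fun a => τ (a, f.toToric hX 1)) := by
  have hq : Topology.IsQuotientMap
      (ToricSpace.mk hX : faceOrbits Δ X lam → ToricSpace Δ X lam Q hX) := isQuotientMap_quotient_mk'
  rw [← hq.isOpen_preimage]
  have : ToricSpace.mk hX ⁻¹' (Set.range fun a => τ (a, f.toToric hX 1)) =
      ⋂ j, {x : faceOrbits Δ X lam | (x : Fin d → ℂ) j ≠ 0} := by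
    ext x
    rw [Set.mem_preimage, f.mem_range_quasitorus_action_iff hX hτ]
    simp
  rw [this]
  refine isOpen_iInter_of_finite fun j => isOpen_ne_fun ?_ continuous_const
  exact (continuous_apply j).comp continuous_subtype_val

-- In each vertex chart the orbit contains the points with nonzero coordinates, which are dense in
-- ℂ^n; the chart maps are continuous and their images cover.
include hτ in
theorem VertexFrame.dense_range_quasitorus_action [FiniteDimensional ℝ E]
    (hn : Module.finrank ℝ E = n) (hΔ : IsSimplePolytope n Δ) (hN : AreInwardNormals n Δ X lam)
    (f : VertexFrame n Δ X lam) : Dense (Set.range fun a => τ (a, f.toToric hX 1)) := by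
  intro m
  obtain ⟨f', u, rfl⟩ := exists_mem_range_toToric hX hn hΔ hN m
  refine closure_mono ?_ (image_closure_subset_closure_image (f'.continuous_toToric hX)
    ⟨u, VertexFrame.dense_nonzeroPoints u, rfl⟩)
  rintro _ ⟨v, hv, rfl⟩
  refine (f.mem_range_quasitorus_action_iff hX hτ).2 fun j => ?_
  by_cases hj : j ∈ Set.range f'.facets
  · obtain ⟨i, rfl⟩ := hj
    change slice f'.facets v _ ≠ 0
    rw [slice_apply f'.facets_injective]
    exact hv i
  · change slice f'.facets v _ ≠ 0
    rw [slice_apply_of_notMem _ hj]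
    exact one_ne_zero

end Action

end Quasifold

end

/-! ### The main theorem -/

theorem theorem2p2 {𝔡 : Type*} [AddCommGroup 𝔡] [Module ℝ 𝔡] [FiniteDimensional ℝ 𝔡]
    {n d : ℕ} (hn : Module.finrank ℝ 𝔡 = n)
    (Δ : Set (Module.Dual ℝ 𝔡)) (hΔ : Quasifold.IsSimplePolytope n Δ)
    (X : Fin d → 𝔡) (lam : Fin d → ℝ) (hnormal : Quasifold.AreInwardNormals n Δ X lam)
    (Q : AddSubgroup 𝔡) (hQ : Quasifold.IsQuasilattice Q) (hX : ∀ j, X j ∈ Q) :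
    -- the quasitorus is a quasifold of one chart
    (∃ 𝒟 : Quasifold.ComplexQuasifold n (Quasifold.Quasitorus Q),
      ∃ c ∈ 𝒟.atlas, Quasifold.IsQuasitorusChart Q c) ∧
    -- the orbit space is a quasifold whose atlas is given by the charts at the vertices
    (∃ 𝒜 : Quasifold.ComplexQuasifold n (Quasifold.ToricSpace Δ X lam Q hX),
      Quasifold.HasVertexCharts Δ X lam Q hX 𝒜) ∧
    -- the quasitorus acts on it, through the action of the torus
    ∃ τ : Quasifold.Quasitorus Q × Quasifold.ToricSpace Δ X lam Q hX →
        Quasifold.ToricSpace Δ X lam Q hX,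
      (∀ (t : Quasifold.Torus d) (z : Quasifold.faceOrbits Δ X lam),
        τ (Quasifold.torusProj X Q hX t, Quasifold.ToricSpace.mk hX z) =
          Quasifold.ToricSpace.mk hX (t +ᵥ z)) ∧
      (∀ (𝒟 : Quasifold.ComplexQuasifold n (Quasifold.Quasitorus Q))
        (𝒜 : Quasifold.ComplexQuasifold n (Quasifold.ToricSpace Δ X lam Q hX)),
        (∃ c ∈ 𝒟.atlas, Quasifold.IsQuasitorusChart Q c) →
        Quasifold.HasVertexCharts Δ X lam Q hX 𝒜 →
        Quasifold.IsHolomorphicAction 𝒟 𝒜 τ) ∧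
      ∃ m₀, IsOpen (Set.range fun a => τ (a, m₀)) ∧ Dense (Set.range fun a => τ (a, m₀)) := by
  have : Countable Q := hQ.countable
  obtain ⟨s, hs⟩ := hΔ.polytope
  -- With no equality imposed the face is `Δ` itself. A single vertex suffices for surjectivity of
  -- Π_ℂ, for a basis of `𝔡` and for the base point of the dense orbit.
  obtain ⟨μ, -, hμ⟩ := Quasifold.IsFace.exists_isVertex hnormal.eq_inter hs
    (Quasifold.isFace_setOf_active hnormal.eq_inter hΔ.nonempty.choose_spec (Set.empty_subset _))
  obtain ⟨f, rfl⟩ := hμ.exists_frame hn hΔ hnormal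
  have hsurj := f.torusProj_surjective hX
  obtain ⟨τ, hτ⟩ := Quasifold.exists_quasitorus_action (Δ := Δ) (lam := lam) hX hsurj
  refine ⟨?_, Quasifold.exists_complexQuasifold_hasVertexCharts hX hn hΔ hnormal, τ, hτ,
    fun 𝒟 𝒜 h𝒟 h𝒜 => Quasifold.isHolomorphicAction_quasitorus_action hX hτ hn hnormal hsurj h𝒟 h𝒜,
    f.toToric hX 1, f.isOpen_range_quasitorus_action hX hτ,
    f.dense_range_quasitorus_action hX hτ hn hΔ hnormal⟩
  obtain ⟨𝒟, h𝒟⟩ := Quasifold.exists_complexQuasifold {Quasifold.quasitorusChart f.basis Q}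
    (fun m => ⟨_, rfl, Quasifold.target_quasitorusChart f.basis Q ▸ trivial⟩)
    (by
      rintro _ rfl _ rfl
      exact Quasifold.Chart.compatible_refl _)
  exact ⟨𝒟, _, h𝒟 rfl, Quasifold.isQuasitorusChart_quasitorusChart f.basis Q⟩
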